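/- **Setting.** Let $\Theta\subset\mathbb R^d$ be compact, $U\supseteq\Theta$ open, and for $\theta\in U$ let $f_\theta:\mathbb N_0^{\mathbb N}\to\mathbb R$ be measurable. Let $Y=(Y_t)_{t\in\mathbb Z}$ be a stationary and ergodic $\mathbb N_0$-valued process, $\mathcal F_{t-1}=\sigma(Y_{t-1},Y_{t-2},\dots)$, and let $\theta^*\in\Theta$ be such that, for some family $p(\cdot;\lambda)$ of probability distributions on $\mathbb N_0$ and all $t$, $$Y_t\mid\mathcal F_{t-1}\sim p(\cdot;\lambda_t(\theta^*)),\qquad \lambda_t(\theta^*)=\mathbb E(Y_t\mid\mathcal F_{t-1}),\qquad \lambda_t(\theta):=f_\theta(Y_{t-1},Y_{t-2},\dots).$$ Put $\widehat\lambda_t(\theta)=f_\theta(Y_{t-1},\dots,Y_1,0,0,\dots)$ and $\ell_t(\theta)=Y_t\log\lambda_t(\theta)-\lambda_t(\theta)$. A model is a subset $m\subseteq\{1,\dots,d\}$ with $|m|$ elements and parameter space $\Theta(m)=\{\theta\in\Theta:\theta_i=0\text{ for }i\notin m\}$. Let $\mathcal M$ be a finite collection of models that contains the true model $m^*$: $\theta^*\in\Theta(m^*)$,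 and every $m\in\mathcal M$ with $\theta^*\in\Theta(m)$ satisfies $m^*\subseteq m$ (as is the case when $m^*=\{i:\theta^*_i\ne0\}$). For $n\in\mathbb N$ let $$\widehat L_n(\theta)=\sum_{t=1}^n\big(Y_t\log\widehat\lambda_t(\theta)-\widehat\lambda_t(\theta)\big),\qquad \widehat\theta_n(m)\in\operatorname*{argmax}_{\theta\in\Theta(m)}\widehat L_n(\theta)\quad(m\in\mathcal M),$$ $$\widehat m_n\in\operatorname*{argmin}_{m\in\mathcal M}\big(-2\widehat L_n(\widehat\theta_n(m))+\kappa_n|m|\big).$$ **Assumptions.** Let $a_t=\sup_{\theta\in\Theta}|\widehat\lambda_t(\theta)-\lambda_t(\theta)|$, $b_t=\sup_{\theta\in\Theta}\mathbb E\|\partial_\theta\widehat\lambda_t(\theta)-\partial_\theta\lambda_t(\theta)\|$ and $d_t=\sup_{\theta\in\Theta}\max\{\mathbb E\|\widehat\lambda_t(\theta)^{-1}\partial_\theta\widehat\lambda_t(\theta)\|,\ \mathbb E\|\lambda_t(\theta)^{-1}\partial_\theta\lambda_t(\theta)\|\}$, with values in $[0,\infty]$. - (A0) If $\theta,\theta'\in\Theta$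 and $\lambda_t(\theta)=\lambda_t(\theta')$ a.s. for some $t$, then $\theta=\theta'$; and there is $\underline c>0$ with $f_\theta(y)\ge\underline c$ for all $\theta\in\Theta$ and all $y$. - (A1) $\theta^*$ is an interior point of $\Theta(m^*)$ relative to the subspace $\{\theta\in\mathbb R^d:\theta_i=0\text{ for }i\notin m^*\}$. - (A2) For every $y$, $\theta\mapsto f_\theta(y)$ is twice continuously differentiable on $U$. - (A3) $a_t\to0$ and $Y_ta_t\to0$ a.s. as $t\to\infty$. - (A4) The matrices $J(\theta^*)=\mathbb E\big[\lambda_t(\theta^*)^{-1}\,\partial_\theta\lambda_t(\theta^*)\,\partial_{\theta'}\lambda_t(\theta^*)\big]$ and $I(\theta^*)=\mathbb E\big[\operatorname{Var}(Y_t\mid\mathcal F_{t-1})\,\lambda_t(\theta^*)^{-2}\,\partial_\theta\lambda_t(\theta^*)\,\partial_{\theta'}\lambda_t(\theta^*)\big]$ are finite. - (A5) For $c\in\mathbb R^d$, $c'\,\partial_\theta\lambda_t(\theta^*)=0$ a.s. implies $c=0$. - (A6) There is $V\subseteq U$, star-shaped about $\theta^*$ and a neighbourhood of $\theta^*$ relative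 to $\Theta$ (that is, $V$ contains $\Theta\cap W$ for some neighbourhood $W$ of $\theta^*$ in $\mathbb R^d$), such that $f_\theta(y)>0$ for all $\theta\in V$ and all $y$, and $\mathbb E\big[\sup_{\theta\in V}|\partial^2\ell_t(\theta)/\partial\theta_i\partial\theta_j|\big]<\infty$ for all $i,j$. - (A7) For some $h>1/2$, a.s. $b_t$, $b_tY_t$ and $a_td_tY_t$ are $O(t^{-h})$ as $t\to\infty$. - (A$_i(\Theta)$, $i=0,1,2$) There are $\alpha^{(i)}_k\ge0$ ($k\ge1$) with $\sum_k\alpha^{(0)}_k<1$ and $\sum_k\alpha^{(i)}_k<\infty$ for $i=1,2$ such that, for all $y,y'\in\mathbb N_0^{\mathbb N}$, $\sup_{\theta\in\Theta}\|\partial_\theta^if_\theta(y)-\partial_\theta^if_\theta(y')\|\le\sum_{k\ge1}\alpha^{(i)}_k|y_k-y'_k|$ (the right-hand side may be infinite). - (Moments) There are $\epsilon>1$ and $C<\infty$ with $\mathbb E\,Y_t^{1+\epsilon}<C$ for all $t$. - (Penalty) $(\kappa_n)$ is an increasing (not necessarily strictly) real sequence with $\kappa_n\to\infty$, $\kappa_n=o(n)$,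 and $\sum_{\ell\ge1}\kappa_\ell^{-1}\sum_{k\ge\ell}\alpha^{(i)}_k<\infty$ for $i=0,1,2$, where any terms with $\kappa_\ell=0$ are omitted. **Conclusion.** As $n\to\infty$, $$\mathbb P(\widehat m_n=m^*)\to1\qquad\text{and}\qquad\widehat\theta_n(\widehat m_n)\to\theta^*\ \text{ in probability}.$$ -/

import Mathlib

open MeasureTheory Filter Topology
open scoped ENNReal NNReal

noncomputable section

namespace PoissonQL

/-- The parameter space `ℝ^d` with its Euclidean norm. -/
abbrev Param (d : ℕ) : Type := EuclideanSpace ℝ (Fin d)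

/-- The vectors of `ℝ^d` whose components outside the model `m` vanish. -/
def coordSpace {d : ℕ} (m : Finset (Fin d)) : Set (Param d) :=
  {θ | ∀ i, i ∉ m → θ i = 0}

/-- `Θ(m)`: the parameters of the model `m`, a subset of the set of coordinates. -/
def paramSpace {d : ℕ} (Θ : Set (Param d)) (m : Finset (Fin d)) : Set (Param d) :=
  coordSpace m ∩ Θ

variable {Ω : Type*}

/-! ### The process, its past and the conditional means

A sequence `(y_1, y_2, …)` of counts is a function `y : ℕ → ℕ`, with `y k` for `y_{k+1}`. -/

/-- The whole past `(Y_{t-1}, Y_{t-2}, …)`. -/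
def past (Y : ℤ → Ω → ℕ) (t : ℤ) (ω : Ω) : ℕ → ℕ :=
  fun k => Y (t - 1 - k) ω

/-- The observed past `(Y_{t-1}, …, Y_1, 0, 0, …)`. -/
def obsPast (Y : ℤ → Ω → ℕ) (t : ℤ) (ω : Ω) : ℕ → ℕ :=
  fun k => if 1 ≤ t - 1 - (k : ℤ) then Y (t - 1 - k) ω else 0

/-- The σ-field generated by `Y_{t-1}, Y_{t-2}, …`. -/
abbrev pastSigma (Y : ℤ → Ω → ℕ) (t : ℤ) : MeasurableSpace Ω :=
  ⨆ (s : ℤ) (_ : s < t), MeasurableSpace.comap (Y s) inferInstance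

/-- `λ_t(θ) = f_θ(Y_{t-1}, Y_{t-2}, …)`. -/
def lam {d : ℕ} (f : Param d → (ℕ → ℕ) → ℝ) (Y : ℤ → Ω → ℕ) (t : ℤ) (ω : Ω) (θ : Param d) : ℝ :=
  f θ (past Y t ω)

/-- `λ̂_t(θ) = f_θ(Y_{t-1}, …, Y_1, 0, 0, …)`. -/
def lamHat {d : ℕ} (f : Param d → (ℕ → ℕ) → ℝ) (Y : ℤ → Ω → ℕ) (t : ℤ) (ω : Ω)
    (θ : Param d) : ℝ :=
  f θ (obsPast Y t ω)

/-- `ℓ_t(θ) = Y_t log λ_t(θ) - λ_t(θ)`. -/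
def ell {d : ℕ} (f : Param d → (ℕ → ℕ) → ℝ) (Y : ℤ → Ω → ℕ) (t : ℤ) (ω : Ω) (θ : Param d) : ℝ :=
  (Y t ω : ℝ) * Real.log (lam f Y t ω θ) - lam f Y t ω θ

/-- `ℓ̂_t(θ) = Y_t log λ̂_t(θ) - λ̂_t(θ)`. -/
def ellHat {d : ℕ} (f : Param d → (ℕ → ℕ) → ℝ) (Y : ℤ → Ω → ℕ) (t : ℤ) (ω : Ω)
    (θ : Param d) : ℝ :=
  (Y t ω : ℝ) * Real.log (lamHat f Y t ω θ) - lamHat f Y t ω θ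

/-- The Poisson quasi-log-likelihood `L̂_n(θ)` computed from `Y_1, …, Y_n`. -/
def LHat {d : ℕ} (f : Param d → (ℕ → ℕ) → ℝ) (Y : ℤ → Ω → ℕ) (n : ℕ) (ω : Ω) (θ : Param d) : ℝ :=
  ∑ t ∈ Finset.Icc 1 n, ellHat f Y (t : ℤ) ω θ

/-- The penalized criterion `-2 L̂_n(θ̂(m)) + κ_n |m|`, with `th` the value of `θ̂(m)`. -/
def crit {d : ℕ} (f : Param d → (ℕ → ℕ) → ℝ) (Y : ℤ → Ω → ℕ) (κ : ℕ → ℝ) (n : ℕ) (ω : Ω)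
    (th : Param d) (m : Finset (Fin d)) : ℝ :=
  -2 * LHat f Y n ω th + κ n * (m.card : ℝ)

/-! ### Derivatives -/

/-- `∂g/∂θ_i` at `θ`. -/
def pderiv {d : ℕ} (g : Param d → ℝ) (i : Fin d) (θ : Param d) : ℝ :=
  fderiv ℝ g θ (EuclideanSpace.single i 1)

/-- `∂²g/∂θ_i∂θ_j` at `θ`. -/
def pderiv2 {d : ℕ} (g : Param d → ℝ) (i j : Fin d) (θ : Param d) : ℝ :=
  pderiv (pderiv g j) i θ

/-! ### The model and the assumptions -/

/-- `Y` is (strictly) stationary and ergodic: the shift preserves its law on `ℕ^ℤ` and is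
ergodic for it. -/
def StationaryErgodic [MeasurableSpace Ω] (μ : Measure Ω) (Y : ℤ → Ω → ℕ) : Prop :=
  (∀ t, Measurable (Y t)) ∧
    Ergodic (fun (x : ℤ → ℕ) (t : ℤ) => x (t + 1)) (μ.map (fun ω t => Y t ω))

/-- `Y` belongs to the class of observation-driven models with mean function `g` and conditional
distributions `p(· ; λ)`: given the past, `Y_t` has distribution `p(· ; λ_t)`, where
`λ_t = g(Y_{t-1}, Y_{t-2}, …)` is the conditional mean of `Y_t`. -/
def IsOD [MeasurableSpace Ω] (μ : Measure Ω) (p : ℝ → PMF ℕ) (g : (ℕ → ℕ) → ℝ)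
    (Y : ℤ → Ω → ℕ) : Prop :=
  ∀ t : ℤ,
    (∀ k : ℕ, μ[Set.indicator {ω | Y t ω = k} (fun _ => (1 : ℝ)) | pastSigma Y t]
      =ᵐ[μ] fun ω => (p (g (past Y t ω)) k).toReal) ∧
    μ[fun ω => (Y t ω : ℝ) | pastSigma Y t] =ᵐ[μ] fun ω => g (past Y t ω)

/-- Bounded moments of order `1 + ε` for some `ε > 1`. -/
def MomentCondition [MeasurableSpace Ω] (μ : Measure Ω) (Y : ℤ → Ω → ℕ) : Prop :=
  ∃ ε : ℝ, 1 < ε ∧ ∃ C : ℝ≥0, ∀ t : ℤ, ∫⁻ ω, (Y t ω : ℝ≥0∞) ^ (1 + ε) ∂μ < C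

/-- The parametrized mean function: `U` is an open set that contains the compact set `Θ`, each
`f_θ` with `θ ∈ U` is measurable, and `θ ↦ f_θ(y)` is twice continuously differentiable on `U`
for each `y`. -/
def SmoothFamily {d : ℕ} (f : Param d → (ℕ → ℕ) → ℝ) (U Θ : Set (Param d)) : Prop :=
  IsOpen U ∧ Θ ⊆ U ∧ (∀ θ ∈ U, Measurable (f θ)) ∧ ∀ y, ContDiffOn ℝ 2 (fun θ => f θ y) U

/-- The Lipschitz-type conditions of orders `i = 0, 1, 2`, with `α i k` for `α^{(i)}_{k+1}`. The
right-hand side may be infinite. -/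
def LipschitzCondition {d : ℕ} (f : Param d → (ℕ → ℕ) → ℝ) (Θ : Set (Param d))
    (α : Fin 3 → ℕ → ℝ≥0) : Prop :=
  (∀ i, Summable (α i)) ∧ ∑' k, α 0 k < 1 ∧
    ∀ (i : Fin 3) (y y' : ℕ → ℕ), ∀ θ ∈ Θ,
      ‖iteratedFDeriv ℝ (i : ℕ) (fun η => f η y) θ
          - iteratedFDeriv ℝ (i : ℕ) (fun η => f η y') θ‖ₑ
        ≤ ∑' k, (α i k : ℝ≥0∞) * (Nat.dist (y k) (y' k) : ℝ≥0∞)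

/-- Identifiability, and a positive lower bound on the mean functions. -/
def Identifiable [MeasurableSpace Ω] (μ : Measure Ω) {d : ℕ} (f : Param d → (ℕ → ℕ) → ℝ)
    (Y : ℤ → Ω → ℕ) (Θ : Set (Param d)) : Prop :=
  (∀ θ ∈ Θ, ∀ θ' ∈ Θ, (∃ t : ℤ, ∀ᵐ ω ∂μ, lam f Y t ω θ = lam f Y t ω θ') → θ = θ') ∧
    ∃ c : ℝ, 0 < c ∧ ∀ θ ∈ Θ, ∀ y, c ≤ f θ y

/-- `a_t = sup_{θ ∈ Θ} |λ̂_t(θ) - λ_t(θ)|`. -/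
def supErr {d : ℕ} (f : Param d → (ℕ → ℕ) → ℝ) (Y : ℤ → Ω → ℕ) (Θ : Set (Param d)) (t : ℤ)
    (ω : Ω) : ℝ≥0∞ :=
  ⨆ θ ∈ Θ, ‖lamHat f Y t ω θ - lam f Y t ω θ‖ₑ

/-- `b_t = sup_{θ ∈ Θ} E‖∂λ̂_t(θ)/∂θ - ∂λ_t(θ)/∂θ‖`. -/
def supDerivErr [MeasurableSpace Ω] (μ : Measure Ω) {d : ℕ} (f : Param d → (ℕ → ℕ) → ℝ)
    (Y : ℤ → Ω → ℕ) (Θ : Set (Param d)) (t : ℤ) : ℝ≥0∞ :=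
  ⨆ θ ∈ Θ, ∫⁻ ω, ‖fderiv ℝ (lamHat f Y t ω) θ - fderiv ℝ (lam f Y t ω) θ‖ₑ ∂μ

/-- `d_t = sup_{θ ∈ Θ} max (E‖λ̂_t(θ)⁻¹ ∂λ̂_t(θ)/∂θ‖, E‖λ_t(θ)⁻¹ ∂λ_t(θ)/∂θ‖)`. -/
def supLogDeriv [MeasurableSpace Ω] (μ : Measure Ω) {d : ℕ} (f : Param d → (ℕ → ℕ) → ℝ)
    (Y : ℤ → Ω → ℕ) (Θ : Set (Param d)) (t : ℤ) : ℝ≥0∞ :=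
  ⨆ θ ∈ Θ, max (∫⁻ ω, ‖(lamHat f Y t ω θ)⁻¹ • fderiv ℝ (lamHat f Y t ω) θ‖ₑ ∂μ)
    (∫⁻ ω, ‖(lam f Y t ω θ)⁻¹ • fderiv ℝ (lam f Y t ω) θ‖ₑ ∂μ)

/-- Almost surely `a_t → 0` and `Y_t a_t → 0` as `t → ∞`. -/
def InitialValueNegligible [MeasurableSpace Ω] (μ : Measure Ω) {d : ℕ}
    (f : Param d → (ℕ → ℕ) → ℝ) (Y : ℤ → Ω → ℕ) (Θ : Set (Param d)) : Prop :=
  ∀ᵐ ω ∂μ, Tendsto (fun t : ℕ => supErr f Y Θ t ω) atTop (𝓝 0) ∧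
    Tendsto (fun t : ℕ => (Y t ω : ℝ≥0∞) * supErr f Y Θ t ω) atTop (𝓝 0)

/-- The matrices `J(θ*)` and `I(θ*)` are finite. -/
def FiniteInformation [MeasurableSpace Ω] (μ : Measure Ω) {d : ℕ} (f : Param d → (ℕ → ℕ) → ℝ)
    (Y : ℤ → Ω → ℕ) (θs : Param d) : Prop :=
  ∀ (t : ℤ) (i j : Fin d),
    Integrable (fun ω => (lam f Y t ω θs)⁻¹ *
      (pderiv (lam f Y t ω) i θs * pderiv (lam f Y t ω) j θs)) μ ∧
    Integrable (fun ω =>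
      ProbabilityTheory.condVar (pastSigma Y t) (fun ω' => (Y t ω' : ℝ)) μ ω
        / (lam f Y t ω θs) ^ 2 *
      (pderiv (lam f Y t ω) i θs * pderiv (lam f Y t ω) j θs)) μ

/-- For `c ∈ ℝ^d`, if `c' ∂λ_t(θ*)/∂θ = 0` almost surely then `c = 0`. -/
def NondegenerateGradient [MeasurableSpace Ω] (μ : Measure Ω) {d : ℕ}
    (f : Param d → (ℕ → ℕ) → ℝ) (Y : ℤ → Ω → ℕ) (θs : Param d) : Prop :=
  ∀ (t : ℤ) (c : Param d),
    (∀ᵐ ω ∂μ, ∑ i, c i * pderiv (lam f Y t ω) i θs = 0) → c = 0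

/-- There is a neighbourhood `V` of `θ*` in which `ℓ_t` is well defined and on which the second
derivatives of `ℓ_t` are dominated in mean. `V` may be a neighbourhood relative to `Θ`, so that
`θ*` may lie on the boundary of `Θ`, and is taken star-shaped about `θ*`; a neighbourhood of `θ*`
in `ℝ^d` can always be shrunk to a ball. -/
def DominatedHessian [MeasurableSpace Ω] (μ : Measure Ω) {d : ℕ} (f : Param d → (ℕ → ℕ) → ℝ)
    (Y : ℤ → Ω → ℕ) (U Θ : Set (Param d)) (θs : Param d) : Prop :=
  ∃ V : Set (Param d), V ∈ 𝓝[Θ] θs ∧ StarConvex ℝ θs V ∧ V ⊆ U ∧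
    (∀ θ ∈ V, ∀ y, 0 < f θ y) ∧
    ∀ (t : ℤ) (i j : Fin d), ∫⁻ ω, ⨆ θ ∈ V, ‖pderiv2 (ell f Y t ω) i j θ‖ₑ ∂μ < ∞

/-- Almost surely `b_t`, `b_t Y_t` and `a_t d_t Y_t` are `O(t^{-h})` for some `h > 1/2`. -/
def InitialValueRate [MeasurableSpace Ω] (μ : Measure Ω) {d : ℕ} (f : Param d → (ℕ → ℕ) → ℝ)
    (Y : ℤ → Ω → ℕ) (Θ : Set (Param d)) : Prop :=
  ∃ h : ℝ, 1 / 2 < h ∧ ∀ᵐ ω ∂μ, ∃ C : ℝ, ∀ᶠ t : ℕ in atTop,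
    supDerivErr μ f Y Θ t ≤ ENNReal.ofReal (C * (t : ℝ) ^ (-h)) ∧
    supDerivErr μ f Y Θ t * (Y t ω : ℝ≥0∞) ≤ ENNReal.ofReal (C * (t : ℝ) ^ (-h)) ∧
    supErr f Y Θ t ω * supLogDeriv μ f Y Θ t * (Y t ω : ℝ≥0∞)
      ≤ ENNReal.ofReal (C * (t : ℝ) ^ (-h))

/-- `m*` is the true model within the finite collection `M`: it belongs to `M`, the true parameter
belongs to `Θ(m*)`, and every model of `M` that contains the true parameter contains `m*`. -/
def IsTrueModel {d : ℕ} (M : Finset (Finset (Fin d))) (Θ : Set (Param d)) (θs : Param d)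
    (ms : Finset (Fin d)) : Prop :=
  ms ∈ M ∧ θs ∈ paramSpace Θ ms ∧ ∀ m ∈ M, θs ∈ paramSpace Θ m → ms ⊆ m

/-- `θ*` is an interior point of `Θ(m*)`, relative to the coordinate subspace of `m*`. -/
def InteriorParam {d : ℕ} (Θ : Set (Param d)) (θs : Param d) (ms : Finset (Fin d)) : Prop :=
  θs ∈ paramSpace Θ ms ∧ paramSpace Θ ms ∈ 𝓝[coordSpace ms] θs

/-- The regularization parameter: `κ` is increasing, `κ_n → ∞`, `κ_n = o(n)`, and
`∑_{l ≥ 1} κ_l⁻¹ ∑_{k ≥ l} α^{(i)}_k < ∞` for `i = 0, 1, 2`, with `α i k` for `α^{(i)}_{k+1}`. -/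
def PenaltyCondition (κ : ℕ → ℝ) (α : Fin 3 → ℕ → ℝ≥0) : Prop :=
  Monotone κ ∧ Tendsto κ atTop atTop ∧ (κ =o[atTop] fun n : ℕ => (n : ℝ)) ∧
    ∀ i, Summable fun l : ℕ => (κ (l + 1))⁻¹ * ∑' k : ℕ, (α i (l + k) : ℝ)

/-- `thHat n m` is, for each `m ∈ M`, a maximizer of `L̂_n` over `Θ(m)`. -/
def IsPQMLE [MeasurableSpace Ω] (μ : Measure Ω) {d : ℕ} (f : Param d → (ℕ → ℕ) → ℝ)
    (Y : ℤ → Ω → ℕ) (Θ : Set (Param d)) (M : Finset (Finset (Fin d)))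
    (thHat : ℕ → Finset (Fin d) → Ω → Param d) : Prop :=
  ∀ n, ∀ m ∈ M, ∀ᵐ ω ∂μ, thHat n m ω ∈ paramSpace Θ m ∧
    IsMaxOn (LHat f Y n ω) (paramSpace Θ m) (thHat n m ω)

/-- `mHat n` minimizes the penalized criterion over `M`. -/
def IsSelectedModel [MeasurableSpace Ω] (μ : Measure Ω) {d : ℕ} (f : Param d → (ℕ → ℕ) → ℝ)
    (Y : ℤ → Ω → ℕ) (κ : ℕ → ℝ) (M : Finset (Finset (Fin d)))
    (thHat : ℕ → Finset (Fin d) → Ω → Param d) (mHat : ℕ → Ω → Finset (Fin d)) : Prop :=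
  ∀ n, ∀ᵐ ω ∂μ, mHat n ω ∈ M ∧ ∀ m ∈ M,
    crit f Y κ n ω (thHat n (mHat n ω) ω) (mHat n ω) ≤ crit f Y κ n ω (thHat n m ω) m

end PoissonQL

end

/-! The argument compares the penalized criterion of the selected model with that of the true one.
Within the true model only `LHat(θ*) ≤ LHat(θ̂(m*))` is needed, so everything reduces to an upper
bound for `LHat(θ) - LHat(θ*)`, uniform over `θ ∈ Θ`, at the scale of `κ_n`.

First, the unobserved past is negligible at that scale. The order-zero Lipschitz condition, the
lower bound on the means and second moments bound the expected error of the `l`-th term by a tail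
sum of `α^{(0)}`. The penalty condition makes the accumulated error `o(κ_n)` in probability
(`tendsto_measure_LHat_sub_LFull`), so `LHat` may be replaced by the stationary sum `LFull`.

Away from `θ*` the expected loss is that of a Poisson Kullback-Leibler divergence, positive by
identifiability. A locally uniform law of large numbers and compactness turn it into a loss of at
least `δ n` (`exists_tendsto_measure_LFull_far`), which a penalty of order `o(n)` cannot offset.
Hence the selected estimator is close to `θ*`.

Near `θ*` the gain is stochastically bounded, hence below any `ε κ_n`
(`exists_tendsto_measure_LFull_near`). Indeed the score is a sum of orthogonal martingale
differences, of order `√n`, and the Hessian is close to `-n J(θ*)` with `J(θ*)` positive definite.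
By Taylor's formula the gain is at most a linear term minus a quadratic one, whose maximum has order
`|score|² / n`.

Finally, a parameter of `Θ(m)` close enough to `θ*` cannot miss a nonzero coordinate of `θ*`, so `θ*
∈ Θ(m)` and `m* ⊆ m`. A strict inclusion would cost at least `κ_n` and gain less than `κ_n / 2`. -/

namespace PoissonQL

/-! ### Mean ergodic theorem and weak law of large numbers -/

section Ergodic

variable {X : Type*} [MeasurableSpace X] {ν : Measure X} {T : X → X}

theorem memLp_comp_iterate {E : Type*} [NormedAddCommGroup E] {p : ℝ≥0∞} {g : X → E}
    (hT : MeasurePreserving T ν ν) (hg : MemLp g p ν) (k : ℕ) :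
    MemLp (fun x => g (T^[k] x)) p ν :=
  hg.comp_measurePreserving (hT.iterate k)

theorem integral_comp_iterate {g : X → ℝ} (hT : MeasurePreserving T ν ν)
    (hg : AEStronglyMeasurable g ν) (k : ℕ) :
    ∫ x, g (T^[k] x) ∂ν = ∫ x, g x ∂ν := by
  have h := hT.iterate k
  conv_rhs => rw [← h.map_eq]
  rw [integral_map h.measurable.aemeasurable (by rwa [h.map_eq])]

theorem memLp_birkhoffAverage {p : ℝ≥0∞} {g : X → ℝ} (hT : MeasurePreserving T ν ν)
    (hg : MemLp g p ν) (n : ℕ) : MemLp (birkhoffAverage ℝ T g n) p ν := by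
  have : birkhoffAverage ℝ T g n
      = (n : ℝ)⁻¹ • fun x => ∑ k ∈ Finset.range n, g (T^[k] x) := by
    ext x; simp [birkhoffAverage, birkhoffSum]
  rw [this]
  exact (memLp_finsetSum _ fun k _ => memLp_comp_iterate hT hg k).const_smul _

theorem integrable_birkhoffAverage {g : X → ℝ} (hT : MeasurePreserving T ν ν)
    (hg : Integrable g ν) (n : ℕ) : Integrable (birkhoffAverage ℝ T g n) ν :=
  memLp_one_iff_integrable.1 (memLp_birkhoffAverage hT (memLp_one_iff_integrable.2 hg) n)

theorem integral_birkhoffAverage {g : X → ℝ} (hT : MeasurePreserving T ν ν)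
    (hg : Integrable g ν) {n : ℕ} (hn : n ≠ 0) :
    ∫ x, birkhoffAverage ℝ T g n x ∂ν = ∫ x, g x ∂ν := by
  simp only [birkhoffAverage, birkhoffSum, smul_eq_mul]
  rw [integral_const_mul, integral_finsetSum]
  · simp_rw [integral_comp_iterate hT hg.aestronglyMeasurable]
    simp [hn]
  · intro k _
    exact (hT.iterate k).integrable_comp_of_integrable hg

theorem integral_abs_birkhoffAverage_le {g : X → ℝ} (hT : MeasurePreserving T ν ν)
    (hg : Integrable g ν) (n : ℕ) :
    ∫ x, |birkhoffAverage ℝ T g n x| ∂ν ≤ ∫ x, |g x| ∂ν := by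
  rcases eq_or_ne n 0 with rfl | hn
  · simpa using integral_nonneg fun x => abs_nonneg (g x)
  rw [← integral_birkhoffAverage hT hg.abs hn]
  refine integral_mono (integrable_birkhoffAverage hT hg n).abs
    (integrable_birkhoffAverage hT hg.abs n) fun x => ?_
  simp only [birkhoffAverage, birkhoffSum, smul_eq_mul, abs_mul, abs_inv, Nat.abs_cast]
  gcongr
  exact Finset.abs_sum_le_sum_abs _ _

/-- Mean ergodic theorem for a square integrable function, with convergence in mean. -/
theorem tendsto_integral_abs_birkhoffAverage_of_memLp_two [IsProbabilityMeasure ν]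
    {g : X → ℝ} (hT : Ergodic T ν) (hg : MemLp g 2 ν) :
    Tendsto (fun n => ∫ x, |birkhoffAverage ℝ T g n x - ∫ y, g y ∂ν| ∂ν) atTop (𝓝 0) := by
  have hmp := hT.toMeasurePreserving
  -- The Koopman operator is an isometry of `L²`, so von Neumann's theorem applies: its averages
  -- converge to the projection onto its fixed vectors.
  set K : Lp ℝ 2 ν →L[ℝ] Lp ℝ 2 ν :=
    (Lp.compMeasurePreservingₗᵢ ℝ T hmp).toContinuousLinearMap with hK
  have hKn : ‖K‖ ≤ 1 := LinearIsometry.norm_toContinuousLinearMap_le _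
  have hiter : ∀ k, K^[k] (hg.toLp g) = (memLp_comp_iterate hmp hg k).toLp _ := by
    intro k
    induction k with
    | zero => rfl
    | succ k ih =>
      rw [Function.iterate_succ_apply', ih]
      change Lp.compMeasurePreserving T hmp _ = _
      rw [Lp.toLp_compMeasurePreserving]
      congr 1
  have hlim := K.tendsto_birkhoffAverage_orthogonalProjection hKn (hg.toLp g)
  set P := (K.eqLocus (1 : Lp ℝ 2 ν →L[ℝ] Lp ℝ 2 ν)).orthogonalProjectionOnto (hg.toLp g)
    with hP
  have hPfix : K (P : Lp ℝ 2 ν) = P := P.2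
  -- A fixed vector is an almost everywhere invariant function, hence constant by ergodicity.
  obtain ⟨c, hc⟩ : ∃ c : ℝ, (P : Lp ℝ 2 ν) =ᵐ[ν] Function.const X c := by
    refine hT.ae_eq_const_of_ae_eq_comp_ae (Lp.aestronglyMeasurable _) ?_
    have := Lp.coeFn_compMeasurePreserving (P : Lp ℝ 2 ν) hmp
    refine this.symm.trans ?_
    change (K (P : Lp ℝ 2 ν)) =ᵐ[ν] _
    rw [hPfix]
  have hA : ∀ n, (birkhoffAverage ℝ K _root_.id n (hg.toLp g) : Lp ℝ 2 ν)
      = (memLp_birkhoffAverage hmp hg n).toLp _ := by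
    intro n
    simp only [birkhoffAverage, birkhoffSum, hiter, id]
    apply Lp.ext
    refine (Lp.coeFn_smul _ _).trans (EventuallyEq.trans ?_ (MemLp.coeFn_toLp _).symm)
    have h1 : ∀ k, ((memLp_comp_iterate hmp hg k).toLp _ : X → ℝ)
        =ᵐ[ν] fun x => g (T^[k] x) := fun k => MemLp.coeFn_toLp _
    have h2 := Lp.coeFn_finsetSum (Finset.range n)
      (fun k => (memLp_comp_iterate hmp hg k).toLp _)
    filter_upwards [ae_all_iff.2 h1, h2] with x hx1 hx2
    simp only [Pi.smul_apply, hx2, birkhoffAverage, birkhoffSum, smul_eq_mul, Finset.sum_apply, hx1]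
  have hle : ∀ n, ∫ x, |birkhoffAverage ℝ T g n x - c| ∂ν
      ≤ ‖(birkhoffAverage ℝ K _root_.id n (hg.toLp g) : Lp ℝ 2 ν) - P‖ := by
    intro n
    have hm : MemLp (fun x => birkhoffAverage ℝ T g n x - c) 2 ν :=
      (memLp_birkhoffAverage hmp hg n).sub (memLp_const c)
    have h1 : ‖(birkhoffAverage ℝ K _root_.id n (hg.toLp g) : Lp ℝ 2 ν) - P‖
        = (eLpNorm (fun x => birkhoffAverage ℝ T g n x - c) 2 ν).toReal := by
      rw [Lp.norm_def]
      congr 1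
      refine eLpNorm_congr_ae ?_
      rw [hA]
      filter_upwards [Lp.coeFn_sub ((memLp_birkhoffAverage hmp hg n).toLp _) (P : Lp ℝ 2 ν), hc,
        (memLp_birkhoffAverage hmp hg n).coeFn_toLp] with x h1 h2 h3
      rw [h1, Pi.sub_apply, h2, h3]; rfl
    have h2 : ∫ x, |birkhoffAverage ℝ T g n x - c| ∂ν
        = (eLpNorm (fun x => birkhoffAverage ℝ T g n x - c) 1 ν).toReal := by
      rw [eLpNorm_one_eq_lintegral_enorm, ← integral_norm_eq_lintegral_enorm hm.1]
      rfl
    rw [h1, h2]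
    exact ENNReal.toReal_mono hm.eLpNorm_ne_top
      (eLpNorm_le_eLpNorm_of_exponent_le (by norm_num) hm.1)
  have hlim0 : Tendsto (fun n => ∫ x, |birkhoffAverage ℝ T g n x - c| ∂ν) atTop (𝓝 0) :=
    squeeze_zero (fun n => integral_nonneg fun x => abs_nonneg _) hle
      (tendsto_iff_norm_sub_tendsto_zero.1 hlim)
  have hgi : Integrable g ν := hg.integrable (by norm_num)
  -- All averages have the integral of `g`, and convergence in mean preserves it.
  have hcg : c = ∫ y, g y ∂ν := by
    have h0 : ∀ᶠ n : ℕ in atTop, |(∫ y, g y ∂ν) - c|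
        ≤ ∫ x, |birkhoffAverage ℝ T g n x - c| ∂ν := by
      filter_upwards [eventually_ne_atTop 0] with n hn
      rw [← integral_birkhoffAverage hmp hgi hn]
      have : (∫ x, birkhoffAverage ℝ T g n x ∂ν) - c
          = ∫ x, (birkhoffAverage ℝ T g n x - c) ∂ν := by
        rw [integral_sub (integrable_birkhoffAverage hmp hgi n) (integrable_const c)]; simp
      rw [this]
      exact abs_integral_le_integral_abs
    have h1 := ge_of_tendsto hlim0 h0
    have h2 := abs_nonpos_iff.1 h1
    linarith
  rwa [← hcg]

variable [IsProbabilityMeasure ν]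

/-- Mean ergodic theorem in `L¹`. -/
theorem tendsto_integral_abs_birkhoffAverage {g : X → ℝ} (hT : Ergodic T ν)
    (hg : Integrable g ν) :
    Tendsto (fun n => ∫ x, |birkhoffAverage ℝ T g n x - ∫ y, g y ∂ν| ∂ν) atTop (𝓝 0) := by
  have hmp := hT.toMeasurePreserving
  rw [Metric.tendsto_atTop]
  intro ε hε
  -- Simple functions are square integrable and dense in `L¹`, and averaging contracts the `L¹`
  -- norm. This carries the `L²` case over to `g`.
  obtain ⟨s, hs, hsm⟩ := (memLp_one_iff_integrable.2 hg).exists_simpleFunc_eLpNorm_sub_lt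
    ENNReal.one_ne_top (ε := ENNReal.ofReal (ε / 4)) (by simpa using hε)
  have hs2 : MemLp s 2 ν := SimpleFunc.memLp_of_isFiniteMeasure s 2 ν
  have hsi : Integrable s ν := memLp_one_iff_integrable.1 hsm
  have hgs : ∫ x, |g x - s x| ∂ν < ε / 4 := by
    rw [eLpNorm_one_eq_lintegral_enorm] at hs
    have h1 : ∫ x, |g x - s x| ∂ν = (∫⁻ x, ‖(g - ⇑s) x‖ₑ ∂ν).toReal := by
      rw [← integral_norm_eq_lintegral_enorm (hg.sub hsi).1]; rfl
    rw [h1]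
    exact (ENNReal.lt_ofReal_iff_toReal_lt hs.ne_top).1 hs
  obtain ⟨N, hN⟩ := Metric.tendsto_atTop.1
    (tendsto_integral_abs_birkhoffAverage_of_memLp_two hT hs2) (ε / 4) (by linarith)
  refine ⟨N, fun n hn => ?_⟩
  have h1 := hN n hn
  rw [Real.dist_eq, sub_zero, abs_of_nonneg (integral_nonneg fun x => abs_nonneg _)] at h1 ⊢
  have hsub : Integrable (fun x => g x - s x) ν := hg.sub hsi
  have h2 := integral_abs_birkhoffAverage_le hmp hsub n
  have h3 : |(∫ y, s y ∂ν) - ∫ y, g y ∂ν| ≤ ∫ x, |g x - s x| ∂ν := by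
    rw [abs_sub_comm, ← integral_sub hg hsi]
    exact abs_integral_le_integral_abs
  have i1 : Integrable (fun x => |birkhoffAverage ℝ T (fun x => g x - s x) n x|) ν :=
    (integrable_birkhoffAverage hmp hsub n).abs
  have i2 : Integrable (fun x => |birkhoffAverage ℝ T s n x - ∫ y, s y ∂ν|) ν :=
    ((integrable_birkhoffAverage hmp hsi n).sub (integrable_const (∫ y, s y ∂ν))).abs
  calc ∫ x, |birkhoffAverage ℝ T g n x - ∫ y, g y ∂ν| ∂ν
      ≤ ∫ x, (|birkhoffAverage ℝ T (fun x => g x - s x) n x|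
          + |birkhoffAverage ℝ T s n x - ∫ y, s y ∂ν|
          + |(∫ y, s y ∂ν) - ∫ y, g y ∂ν|) ∂ν := by
        refine integral_mono
          ((integrable_birkhoffAverage hmp hg n).sub (integrable_const _)).abs
          ((i1.add i2).add (integrable_const _)) fun x => ?_
        have hb : birkhoffAverage ℝ T g n x = birkhoffAverage ℝ T (fun x => g x - s x) n x
            + birkhoffAverage ℝ T s n x := by
          simp [birkhoffAverage, birkhoffSum, Finset.sum_sub_distrib, mul_sub]
        simp only [hb]
        refine le_trans (le_of_eq ?_) (abs_add_three _ _ _)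
        congr 1; ring
    _ = (∫ x, |birkhoffAverage ℝ T (fun x => g x - s x) n x| ∂ν)
          + (∫ x, |birkhoffAverage ℝ T s n x - ∫ y, s y ∂ν| ∂ν)
          + |(∫ y, s y ∂ν) - ∫ y, g y ∂ν| := by
        rw [integral_add (by exact i1.add i2) (integrable_const _), integral_add i1 i2]; simp
    _ < ε := by linarith

/-- Weak law of large numbers along an ergodic transformation. -/
theorem tendsto_measure_birkhoffAverage {g : X → ℝ} (hT : Ergodic T ν)
    (hg : Integrable g ν) {ε : ℝ} (hε : 0 < ε) :
    Tendsto (fun n => ν {x | ε ≤ |birkhoffAverage ℝ T g n x - ∫ y, g y ∂ν|}) atTop (𝓝 0) := by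
  have hmp := hT.toMeasurePreserving
  have h := tendsto_integral_abs_birkhoffAverage hT hg
  have h' : Tendsto (fun n => ENNReal.ofReal
      (∫ x, |birkhoffAverage ℝ T g n x - ∫ y, g y ∂ν| ∂ν) / ENNReal.ofReal ε) atTop (𝓝 0) := by
    have := ENNReal.Tendsto.div_const (ENNReal.tendsto_ofReal h) (b := ENNReal.ofReal ε)
      (Or.inr (by simpa using hε))
    simpa using this
  refine tendsto_of_tendsto_of_tendsto_of_le_of_le tendsto_const_nhds h' (fun n => zero_le)
    fun n => ?_
  have hi : Integrable (fun x => birkhoffAverage ℝ T g n x - ∫ y, g y ∂ν) ν :=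
    (integrable_birkhoffAverage hmp hg n).sub (integrable_const _)
  rw [ofReal_integral_eq_lintegral_ofReal hi.abs (ae_of_all _ fun x => abs_nonneg _)]
  refine le_trans (measure_mono fun x hx => ?_) (meas_ge_le_lintegral_div
    hi.abs.aemeasurable.ennreal_ofReal (by simpa using hε) ENNReal.ofReal_ne_top)
  exact ENNReal.ofReal_le_ofReal hx

end Ergodic

/-! ### Locally uniform weak law of large numbers -/

section UniformLaw

variable {X : Type*} [MeasurableSpace X] {E : Type*} [PseudoMetricSpace E]
  [TopologicalSpace.SeparableSpace E]

/-- By continuity in the parameter, the supremum may be taken over a countable dense subset of `S`.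
-/
theorem measurable_biSup_enorm {S : Set E} {F : E → X → ℝ} (hFm : ∀ θ ∈ S, Measurable (F θ))
    (hFc : ∀ x, ContinuousOn (fun θ => F θ x) S) :
    Measurable fun x => ⨆ θ ∈ S, ‖F θ x‖ₑ := by
  obtain ⟨D, hDS, hDc, hD⟩ :=
    (TopologicalSpace.IsSeparable.of_separableSpace S).exists_countable_dense_subset
  have : (fun x => ⨆ θ ∈ S, ‖F θ x‖ₑ) = fun x => ⨆ θ ∈ D, ‖F θ x‖ₑ := by
    ext x
    refine le_antisymm (iSup₂_le fun θ hθ => ?_) (biSup_mono hDS)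
    have hne : (𝓝[D] θ).NeBot := mem_closure_iff_nhdsWithin_neBot.1 (hD hθ)
    have ht : Tendsto (fun η => ‖F η x‖ₑ) (𝓝[D] θ) (𝓝 ‖F θ x‖ₑ) :=
      (continuous_enorm.tendsto _).comp ((hFc x θ hθ).mono hDS)
    refine le_of_tendsto ht ?_
    filter_upwards [self_mem_nhdsWithin] with η hη
    exact le_iSup₂ (f := fun η _ => ‖F η x‖ₑ) η hη
  rw [this]
  exact Measurable.biSup D hDc fun θ hθ => (hFm θ (hDS hθ)).enorm

variable {ν : Measure X}

/-- A dominated continuous family is continuous in mean, locally uniformly in the parameter. -/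
theorem exists_lintegral_oscillation_lt {S : Set E} {F : E → X → ℝ}
    (hFm : ∀ θ ∈ S, Measurable (F θ)) (hFc : ∀ x, ContinuousOn (fun θ => F θ x) S)
    (hdom : ∫⁻ x, ⨆ θ ∈ S, ‖F θ x‖ₑ ∂ν < ∞) {θ₀ : E} (h₀ : θ₀ ∈ S) {ε : ℝ≥0∞} (hε : 0 < ε) :
    ∃ ρ : ℝ, 0 < ρ ∧ ∃ H : X → ℝ≥0∞, Measurable H ∧ ∫⁻ x, H x ∂ν < ε ∧
      ∀ x, ∀ θ ∈ S, dist θ θ₀ < ρ → ‖F θ x - F θ₀ x‖ₑ ≤ H x := by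
  let B : ℕ → Set E := fun n => S ∩ Metric.ball θ₀ (1 / ((n : ℝ) + 1))
  let H : ℕ → X → ℝ≥0∞ := fun n x => ⨆ θ ∈ B n, ‖F θ x - F θ₀ x‖ₑ
  have hHm : ∀ n, Measurable (H n) := fun n =>
    measurable_biSup_enorm (S := B n) (F := fun θ x => F θ x - F θ₀ x)
      (fun θ hθ => (hFm θ hθ.1).sub (hFm θ₀ h₀))
      (fun x => ((hFc x).mono Set.inter_subset_left).sub continuousOn_const)
  have hlim : Tendsto (fun n => ∫⁻ x, H n x ∂ν) atTop (𝓝 (∫⁻ _, 0 ∂ν)) := by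
    -- The oscillation over shrinking balls tends to zero pointwise by continuity and is dominated
    -- by twice the supremum over `S`.
    refine tendsto_lintegral_of_dominated_convergence
      (fun x => 2 * ⨆ θ ∈ S, ‖F θ x‖ₑ) hHm (fun n => ae_of_all _ fun x => ?_) ?_
      (ae_of_all _ fun x => ?_)
    · refine iSup₂_le fun θ hθ => (enorm_sub_le).trans ?_
      refine (add_le_add ?_ ?_).trans (two_mul _).ge
      exacts [le_iSup₂ (f := fun η _ => ‖F η x‖ₑ) θ hθ.1,
        le_iSup₂ (f := fun η _ => ‖F η x‖ₑ) θ₀ h₀]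
    · rw [lintegral_const_mul _ (measurable_biSup_enorm hFm hFc)]
      exact ENNReal.mul_ne_top (by simp) hdom.ne
    · rw [ENNReal.tendsto_nhds_zero]
      intro δ hδ
      have hc : Tendsto (fun θ => ‖F θ x - F θ₀ x‖ₑ) (𝓝[S] θ₀) (𝓝 0) := by
        have := (((hFc x θ₀ h₀).tendsto).sub_const (F θ₀ x)).enorm
        simpa using this
      have hev := (ENNReal.tendsto_nhds_zero.1 hc) δ hδ
      obtain ⟨ρ, hρ, hsub⟩ := Metric.mem_nhdsWithin_iff.1 hev
      obtain ⟨N, hN⟩ := exists_nat_one_div_lt hρ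
      filter_upwards [eventually_ge_atTop N] with n hn
      refine iSup₂_le fun θ hθ => hsub ⟨?_, hθ.1⟩
      refine Metric.ball_subset_ball ?_ hθ.2
      refine le_trans ?_ hN.le
      gcongr
  simp only [lintegral_zero] at hlim
  obtain ⟨n, hn⟩ := ((hlim.eventually_lt_const hε)).exists
  refine ⟨1 / ((n : ℝ) + 1), by positivity, H n, hHm n, hn, fun x θ hθ hd => ?_⟩
  exact le_iSup₂ (f := fun θ (_ : θ ∈ B n) => ‖F θ x - F θ₀ x‖ₑ) θ ⟨hθ, hd⟩

omit [PseudoMetricSpace E] [TopologicalSpace.SeparableSpace E] in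
theorem integrable_of_dominated {S : Set E} {F : E → X → ℝ}
    (hFm : ∀ θ ∈ S, Measurable (F θ))
    (hdom : ∫⁻ x, ⨆ θ ∈ S, ‖F θ x‖ₑ ∂ν < ∞) {θ : E} (hθ : θ ∈ S) : Integrable (F θ) ν :=
  ⟨(hFm θ hθ).aestronglyMeasurable, lt_of_le_of_lt (lintegral_mono fun x =>
    le_iSup₂ (f := fun η _ => ‖F η x‖ₑ) θ hθ) hdom⟩

/-- Locally uniform weak law of large numbers along an ergodic transformation. -/
theorem exists_tendsto_measure_birkhoffAverage [IsProbabilityMeasure ν] {T : X → X}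
    (hT : Ergodic T ν) {S : Set E} {F : E → X → ℝ}
    (hFm : ∀ θ ∈ S, Measurable (F θ)) (hFc : ∀ x, ContinuousOn (fun θ => F θ x) S)
    (hdom : ∫⁻ x, ⨆ θ ∈ S, ‖F θ x‖ₑ ∂ν < ∞) {θ₀ : E} (h₀ : θ₀ ∈ S) {ε : ℝ} (hε : 0 < ε) :
    ∃ ρ : ℝ, 0 < ρ ∧ Tendsto (fun n => ν {x | ∃ θ ∈ S, dist θ θ₀ < ρ ∧
      ε ≤ |birkhoffAverage ℝ T (F θ) n x - ∫ y, F θ₀ y ∂ν|}) atTop (𝓝 0) := by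
  -- Three errors of size `ε / 4` arise: the law of large numbers at `θ₀`, the one for the
  -- oscillation bound `H`, and the mean of `H`.
  obtain ⟨ρ, hρ, H, hHm, hHi, hH⟩ := exists_lintegral_oscillation_lt hFm hFc hdom h₀
    (ε := ENNReal.ofReal (ε / 4)) (by simpa using hε)
  have hHint : Integrable (fun x => (H x).toReal) ν :=
    integrable_toReal_of_lintegral_ne_top hHm.aemeasurable hHi.ne_top
  have hHle : ∫ x, (H x).toReal ∂ν ≤ ε / 4 := by
    rw [integral_toReal hHm.aemeasurable (ae_lt_top hHm hHi.ne_top)]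
    exact ENNReal.toReal_le_of_le_ofReal (by linarith) hHi.le
  have hfin : ∀ᵐ x ∂ν, ∀ k : ℕ, H (T^[k] x) < ∞ := by
    rw [ae_all_iff]
    exact fun k => (hT.toMeasurePreserving.iterate k).quasiMeasurePreserving.ae
      (ae_lt_top hHm hHi.ne_top)
  have h1 := tendsto_measure_birkhoffAverage hT (integrable_of_dominated hFm hdom h₀)
    (ε := ε / 4) (by linarith)
  have h2 := tendsto_measure_birkhoffAverage hT hHint (ε := ε / 4) (by linarith)
  have h12 := h1.add h2
  rw [add_zero] at h12
  refine ⟨ρ, hρ, tendsto_of_tendsto_of_tendsto_of_le_of_le tendsto_const_nhds h12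
    (fun n => zero_le) fun n => ?_⟩
  refine (measure_mono_ae ?_).trans (measure_union_le _ _)
  filter_upwards [hfin] with x hx
  rintro ⟨θ, hθS, hθ, hle⟩
  by_contra hcon
  obtain ⟨c1, c2⟩ := not_or.1 hcon
  have c1' : |birkhoffAverage ℝ T (F θ₀) n x - ∫ y, F θ₀ y ∂ν| < ε / 4 := not_le.1 c1
  have c2' : |birkhoffAverage ℝ T (fun x => (H x).toReal) n x - ∫ y, (H y).toReal ∂ν| < ε / 4 :=
    not_le.1 c2
  have c3 : |birkhoffAverage ℝ T (F θ) n x - birkhoffAverage ℝ T (F θ₀) n x|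
      ≤ birkhoffAverage ℝ T (fun x => (H x).toReal) n x := by
    simp only [birkhoffAverage, birkhoffSum, smul_eq_mul, ← mul_sub, ← Finset.sum_sub_distrib]
    rw [abs_mul, abs_inv, Nat.abs_cast]
    gcongr
    refine (Finset.abs_sum_le_sum_abs _ _).trans (Finset.sum_le_sum fun k _ => ?_)
    rw [← Real.norm_eq_abs, ← toReal_enorm]
    exact ENNReal.toReal_mono (hx k).ne (hH _ θ hθS hθ)
  have c4 := abs_sub_le (birkhoffAverage ℝ T (F θ) n x) (birkhoffAverage ℝ T (F θ₀) n x)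
    (∫ y, F θ₀ y ∂ν)
  have c5 := (abs_lt.1 c2').2
  linarith

end UniformLaw

/-! ### Partial derivatives, Taylor's inequality, the quasi-log-likelihood -/

section Calculus

variable {d : ℕ}

theorem fderiv_apply_eq_sum_pderiv (g : Param d → ℝ) (θ h : Param d) :
    fderiv ℝ g θ h = ∑ i, h i * pderiv g i θ := by
  have hh : h = ∑ i, h i • EuclideanSpace.single i (1 : ℝ) := by
    ext j
    simp [Finset.sum_apply, Pi.single_apply]
  conv_lhs => rw [hh]
  simp [pderiv]

theorem contDiffOn_pderiv {g : Param d → ℝ} {W : Set (Param d)} (hW : IsOpen W) {m n : WithTop ℕ∞}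
    (hg : ContDiffOn ℝ n g W) (hmn : m + 1 ≤ n) (i : Fin d) : ContDiffOn ℝ m (pderiv g i) W :=
  (hg.fderiv_of_isOpen hW hmn).clm_apply contDiffOn_const

theorem pderiv_congr {g g' : Param d → ℝ} {W : Set (Param d)} (hW : IsOpen W)
    (h : Set.EqOn g g' W) (i : Fin d) : Set.EqOn (pderiv g i) (pderiv g' i) W := fun θ hθ => by
  have : g =ᶠ[𝓝 θ] g' := by
    filter_upwards [hW.mem_nhds hθ] with η hη using h hη
  simp [pderiv, this.fderiv_eq]

theorem pderiv_sum {ι : Type*} {s : Finset ι} {g : ι → Param d → ℝ} {θ : Param d}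
    (hg : ∀ t ∈ s, DifferentiableAt ℝ (g t) θ) (i : Fin d) :
    pderiv (fun η => ∑ t ∈ s, g t η) i θ = ∑ t ∈ s, pderiv (g t) i θ := by
  simp [pderiv, fderiv_fun_sum hg]

theorem pderiv2_sum {ι : Type*} {s : Finset ι} {g : ι → Param d → ℝ} {W : Set (Param d)}
    (hW : IsOpen W) (hg : ∀ t ∈ s, ContDiffOn ℝ 2 (g t) W) (i j : Fin d) {θ : Param d}
    (hθ : θ ∈ W) :
    pderiv2 (fun η => ∑ t ∈ s, g t η) i j θ = ∑ t ∈ s, pderiv2 (g t) i j θ := by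
  have h1 : Set.EqOn (pderiv (fun η => ∑ t ∈ s, g t η) j)
      (fun η => ∑ t ∈ s, pderiv (g t) j η) W := fun η hη =>
    pderiv_sum (fun t ht => ((hg t ht).differentiableOn (by norm_num)).differentiableAt
      (hW.mem_nhds hη)) j
  rw [pderiv2, pderiv_congr hW h1 i hθ]
  exact pderiv_sum (fun t ht => ((contDiffOn_pderiv (m := 1) hW (hg t ht)
    (by norm_num) j).differentiableOn (by norm_num)).differentiableAt (hW.mem_nhds hθ)) i

theorem hasDerivAt_comp_line {g : Param d → ℝ} {θ h : Param d} {s : ℝ}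
    (hg : DifferentiableAt ℝ g (θ + s • h)) :
    HasDerivAt (fun s : ℝ => g (θ + s • h)) (∑ i, h i * pderiv g i (θ + s • h)) s := by
  rw [← fderiv_apply_eq_sum_pderiv]
  have h1 : HasDerivAt (fun s : ℝ => θ + s • h) h s := by
    simpa using ((hasDerivAt_id s).smul_const h).const_add θ
  exact hg.hasFDerivAt.comp_hasDerivAt s h1

/-- Second order Taylor inequality along a segment. -/
theorem sub_le_of_pderiv2_le {g : Param d → ℝ} {W : Set (Param d)} (hW : IsOpen W)
    (hg : ContDiffOn ℝ 2 g W) {θ h : Param d} (hseg : ∀ s ∈ Set.Icc (0 : ℝ) 1, θ + s • h ∈ W)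
    {K : ℝ} (hK : ∀ s ∈ Set.Icc (0 : ℝ) 1,
      ∑ j, h j * ∑ i, h i * pderiv2 g i j (θ + s • h) ≤ -K) :
    g (θ + h) - g θ ≤ (∑ i, h i * pderiv g i θ) - K / 2 := by
  have hd1 : ∀ s ∈ Set.Icc (0 : ℝ) 1, HasDerivAt (fun s : ℝ => g (θ + s • h))
      (∑ i, h i * pderiv g i (θ + s • h)) s := fun s hs =>
    hasDerivAt_comp_line ((hg.differentiableOn (by norm_num)).differentiableAt
      (hW.mem_nhds (hseg s hs)))
  have hd2 : ∀ s ∈ Set.Icc (0 : ℝ) 1,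
      HasDerivAt (fun s : ℝ => ∑ i, h i * pderiv g i (θ + s • h))
      (∑ j, h j * ∑ i, h i * pderiv2 g i j (θ + s • h)) s := fun s hs => by
    refine HasDerivAt.fun_sum fun j _ => HasDerivAt.const_mul _ ?_
    exact hasDerivAt_comp_line (((contDiffOn_pderiv (m := 1) hW hg
      (by norm_num) j).differentiableOn (by norm_num)).differentiableAt (hW.mem_nhds (hseg s hs)))
  set φ : ℝ → ℝ := fun s => g (θ + s • h) with hφ
  set φ' : ℝ → ℝ := fun s => ∑ i, h i * pderiv g i (θ + s • h) with hφ'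
  -- The mean value theorem is applied twice: to this corrected function on `[0, 1]`, giving a point
  -- `c`, and then to `φ'` on `[0, c]`. The bound on the second derivative makes the corrected slope
  -- at `c` nonpositive.
  have hψ : ∀ s ∈ Set.Icc (0 : ℝ) 1, HasDerivAt (fun s => φ s - φ' 0 * s + K / 2 * s ^ 2)
      (φ' s - φ' 0 + K * s) s := fun s hs => by
    have := ((hd1 s hs).sub ((hasDerivAt_id s).const_mul (φ' 0))).add
      (((hasDerivAt_id s).pow 2).const_mul (K / 2))
    refine this.congr_deriv ?_
    simp; ring
  obtain ⟨c, hc, hc'⟩ := exists_hasDerivAt_eq_slope _ _ (zero_lt_one' ℝ)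
    (fun s hs => (hψ s hs).continuousAt.continuousWithinAt)
    (fun s hs => hψ s (Set.Ioo_subset_Icc_self hs))
  have hsub : Set.Icc 0 c ⊆ Set.Icc (0 : ℝ) 1 := Set.Icc_subset_Icc_right hc.2.le
  obtain ⟨e, he, he'⟩ := exists_hasDerivAt_eq_slope _ _ hc.1
    (fun s hs => (hd2 s (hsub hs)).continuousAt.continuousWithinAt)
    (fun s hs => hd2 s (hsub (Set.Ioo_subset_Icc_self hs)))
  have hKe := hK e (hsub (Set.Ioo_subset_Icc_self he))
  rw [he', sub_zero, div_le_iff₀ hc.1] at hKe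
  have e0 : φ 0 = g θ := by simp [hφ]
  have e1 : φ 1 = g (θ + h) := by simp [hφ]
  have e2 : φ' 0 = ∑ i, h i * pderiv g i θ := by simp [hφ']
  have hKe' : φ' c - φ' 0 ≤ -K * c := hKe
  rw [← e0, ← e1, ← e2]
  norm_num at hc'
  linarith

/-- A partial derivative is a limit of the measurable difference quotients with steps `1 / (n + 1)`.
-/
theorem measurable_pderiv {X : Type*} [MeasurableSpace X] {F : Param d → X → ℝ}
    {U : Set (Param d)} (hU : IsOpen U) (hm : ∀ θ ∈ U, Measurable (F θ))
    (hd : ∀ x, DifferentiableOn ℝ (fun θ => F θ x) U) (i : Fin d) {θ : Param d} (hθ : θ ∈ U) :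
    Measurable fun x => pderiv (fun η => F η x) i θ := by
  set e : Param d := EuclideanSpace.single i 1 with he
  have hpt : Tendsto (fun n : ℕ => θ + (1 / ((n : ℝ) + 1)) • e) atTop (𝓝 θ) := by
    have := (tendsto_one_div_add_atTop_nhds_zero_nat (𝕜 := ℝ)).smul_const e
    simpa using this.const_add θ
  -- Measurability of `F` is known on `U` only, so the sequence starts once the shifted points have
  -- entered `U`.
  obtain ⟨N, hN⟩ := eventually_atTop.1 (hpt.eventually (hU.mem_nhds hθ))
  refine measurable_of_tendsto_metrizable
    (f := fun n x => ((n + N : ℕ) + 1 : ℝ) * (F (θ + (1 / (((n + N : ℕ) : ℝ) + 1)) • e) x - F θ x))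
    (fun n => ((hm _ (hN _ (by omega))).sub (hm θ hθ)).const_mul _) ?_
  rw [tendsto_pi_nhds]
  intro x
  have hdx : HasFDerivAt (fun θ => F θ x) (fderiv ℝ (fun θ => F θ x) θ) θ :=
    ((hd x).differentiableAt (hU.mem_nhds hθ)).hasFDerivAt
  have hl : HasDerivAt (fun s : ℝ => F (θ + s • e) x) (pderiv (fun η => F η x) i θ) 0 := by
    have h1 : HasDerivAt (fun s : ℝ => θ + s • e) e 0 := by
      simpa using ((hasDerivAt_id (0 : ℝ)).smul_const e).const_add θ
    have h2 : HasFDerivAt (fun θ => F θ x) (fderiv ℝ (fun θ => F θ x) θ) (θ + (0 : ℝ) • e) := by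
      simpa using hdx
    exact h2.comp_hasDerivAt 0 h1
  have hs := hl.tendsto_slope
  have h0 : Tendsto (fun n : ℕ => 1 / (((n + N : ℕ) : ℝ) + 1)) atTop (𝓝[≠] 0) := by
    refine tendsto_nhdsWithin_iff.2 ⟨(tendsto_one_div_add_atTop_nhds_zero_nat (𝕜 := ℝ)).comp
      (tendsto_add_atTop_nat N), Eventually.of_forall fun n => ?_⟩
    simp only [Set.mem_compl_iff, Set.mem_singleton_iff]
    positivity
  refine (hs.comp h0).congr fun n => ?_
  simp [slope_def_field, div_eq_mul_inv, mul_comm]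

/-- The Poisson quasi-log-likelihood of one observation `k`, as a function of the parameter of the
mean `g`. -/
noncomputable def quasiLog (k : ℝ) (g : Param d → ℝ) (θ : Param d) : ℝ := k * Real.log (g θ) - g θ

theorem isOpen_pos {g : Param d → ℝ} {U : Set (Param d)} (hU : IsOpen U) (hg : ContDiffOn ℝ 2 g U) :
    IsOpen {θ | θ ∈ U ∧ 0 < g θ} :=
  hg.continuousOn.isOpen_inter_preimage hU isOpen_Ioi

theorem contDiffOn_quasiLog (k : ℝ) {g : Param d → ℝ} {U : Set (Param d)}
    (hg : ContDiffOn ℝ 2 g U) : ContDiffOn ℝ 2 (quasiLog k g) {θ | θ ∈ U ∧ 0 < g θ} := by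
  have h := hg.mono (fun θ (hθ : θ ∈ {θ | θ ∈ U ∧ 0 < g θ}) => hθ.1)
  exact (contDiffOn_const.mul (h.log fun θ hθ => hθ.2.ne')).sub h

theorem pderiv_quasiLog (k : ℝ) {g : Param d → ℝ} {θ : Param d} (hg : DifferentiableAt ℝ g θ)
    (hpos : 0 < g θ) (i : Fin d) :
    pderiv (quasiLog k g) i θ = (k * (g θ)⁻¹ - 1) * pderiv g i θ := by
  have h := ((hg.hasFDerivAt.log hpos.ne').const_mul k).sub hg.hasFDerivAt
  have : fderiv ℝ (quasiLog k g) θ = _ := h.fderiv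
  simp only [pderiv, this]
  simp; ring

theorem pderiv2_quasiLog (k : ℝ) {g : Param d → ℝ} {U : Set (Param d)} (hU : IsOpen U)
    (hg : ContDiffOn ℝ 2 g U) {θ : Param d} (hθ : θ ∈ U) (hpos : 0 < g θ) (i j : Fin d) :
    pderiv2 (quasiLog k g) i j θ = (k * (g θ)⁻¹ - 1) * pderiv2 g i j θ
      - k * ((g θ ^ 2)⁻¹ * (pderiv g i θ * pderiv g j θ)) := by
  have hd : ∀ η ∈ U, DifferentiableAt ℝ g η := fun η hη =>
    (hg.differentiableOn (by norm_num)).differentiableAt (hU.mem_nhds hη)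
  have h1 : Set.EqOn (pderiv (quasiLog k g) j) (fun η => (k * (g η)⁻¹ - 1) * pderiv g j η)
      {θ | θ ∈ U ∧ 0 < g θ} := fun η hη => pderiv_quasiLog k (hd η hη.1) hη.2 j
  rw [pderiv2, pderiv_congr (isOpen_pos hU hg) h1 i ⟨hθ, hpos⟩]
  have h2 : DifferentiableAt ℝ (pderiv g j) θ := ((contDiffOn_pderiv (m := 1) hU hg
    (by norm_num) j).differentiableOn (by norm_num)).differentiableAt (hU.mem_nhds hθ)
  have h3 : HasFDerivAt (fun η => (g η)⁻¹) (-((g θ ^ 2)⁻¹) • fderiv ℝ g θ) θ :=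
    (hasDerivAt_inv hpos.ne').comp_hasFDerivAt θ (hd θ hθ).hasFDerivAt
  have h4 := ((h3.const_mul k).sub_const 1).mul h2.hasFDerivAt
  have h5 : fderiv ℝ (fun η => (k * (g η)⁻¹ - 1) * pderiv g j η) θ = _ := h4.fderiv
  rw [pderiv, h5]
  simp [pderiv, pderiv2]; ring

end Calculus

/-- A sequence that is summable against the inverse of an increasing unbounded sequence has
partial sums of smaller order than that sequence. -/
theorem tendsto_inv_mul_sum_range {κ x : ℕ → ℝ} (hmono : Monotone κ) (hκ : Tendsto κ atTop atTop)
    (hx : ∀ l, 0 ≤ x l) (hs : Summable fun l => (κ (l + 1))⁻¹ * x l) :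
    Tendsto (fun n => (κ n)⁻¹ * ∑ l ∈ Finset.range n, x l) atTop (𝓝 0) := by
  -- Early values of `κ` may be zero or negative. The first `N` terms are therefore bounded
  -- separately; for the later ones monotonicity gives `(κ n)⁻¹ ≤ (κ (l + 1))⁻¹`.
  obtain ⟨N, hN⟩ := eventually_atTop.1 (hκ.eventually_ge_atTop 1)
  have h := tendsto_tsum_of_dominated_convergence (𝓕 := atTop) (G := ℝ)
    (f := fun n l => if l < n then (κ n)⁻¹ * x l else 0) (g := fun _ => (0 : ℝ))
    (bound := fun l => |(κ (l + 1))⁻¹ * x l| + if l ∈ Finset.range N then x l else 0)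
    (hs.abs.add (summable_of_ne_finset_zero (s := Finset.range N) fun b hb => by simp_all))
    (fun l => ?_) ?_
  · simp only [tsum_zero] at h
    refine h.congr fun n => ?_
    rw [tsum_eq_sum (s := Finset.range n), Finset.mul_sum]
    · exact Finset.sum_congr rfl fun l hl => if_pos (Finset.mem_range.1 hl)
    · intro l hl
      exact if_neg fun h => hl (Finset.mem_range.2 h)
  · have h1 : Tendsto (fun n => (κ n)⁻¹ * x l) atTop (𝓝 0) := by
      simpa using hκ.inv_tendsto_atTop.mul_const (x l)
    refine h1.congr' ?_
    filter_upwards [eventually_gt_atTop l] with n hn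
    rw [if_pos hn]
  · filter_upwards [eventually_ge_atTop N] with n hn l
    have hn1 := hN n hn
    by_cases hl : l < n
    · rw [if_pos hl, Real.norm_eq_abs, abs_of_nonneg (mul_nonneg (by positivity) (hx l))]
      by_cases hlN : l < N
      · rw [if_pos (Finset.mem_range.2 hlN)]
        have : (κ n)⁻¹ * x l ≤ x l := mul_le_of_le_one_left (hx l) (inv_le_one_of_one_le₀ hn1)
        linarith [abs_nonneg ((κ (l + 1))⁻¹ * x l)]
      · rw [if_neg (by simpa using hlN), add_zero]
        refine le_trans ?_ (le_abs_self _)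
        have h1 : 1 ≤ κ (l + 1) := hN _ (by omega)
        have h2 : κ (l + 1) ≤ κ n := hmono (by omega)
        have := hx l
        gcongr
    · rw [if_neg hl, norm_zero]
      have := hx l
      positivity

/-! ### The effect of the unobserved past -/

section CountProcess

variable {Ω : Type*} [MeasurableSpace Ω] {μ : Measure Ω} {d : ℕ}
  {f : Param d → (ℕ → ℕ) → ℝ} {Y : ℤ → Ω → ℕ} {Θ : Set (Param d)} {α : Fin 3 → ℕ → ℝ≥0}

theorem exists_lintegral_sq_le (hmom : MomentCondition μ Y) :
    ∃ C : ℝ≥0, ∀ t, ∫⁻ ω, (Y t ω : ℝ≥0∞) ^ 2 ∂μ ≤ C := by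
  obtain ⟨ε, hε, C, hC⟩ := hmom
  refine ⟨C, fun t => le_trans (lintegral_mono fun ω => ?_) (hC t).le⟩
  rcases Nat.eq_zero_or_pos (Y t ω) with h | h
  · simp [h]
  · have h1 : (1 : ℝ≥0∞) ≤ (Y t ω : ℝ≥0∞) := by exact_mod_cast h
    rw [← ENNReal.rpow_natCast]
    exact ENNReal.rpow_le_rpow_of_exponent_le h1 (by push_cast; linarith)

/-- The bound on `|λ̂_t(θ) - λ_t(θ)|` that follows from the Lipschitz condition. -/
noncomputable def pastErr (α : Fin 3 → ℕ → ℝ≥0) (Y : ℤ → Ω → ℕ) (t : ℤ) (ω : Ω) : ℝ≥0∞ :=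
  ∑' k, (α 0 k : ℝ≥0∞) * (Nat.dist (obsPast Y t ω k) (past Y t ω k) : ℝ≥0∞)

omit [MeasurableSpace Ω] in
theorem enorm_sub_le_of_lipschitz (hLip : LipschitzCondition f Θ α) {θ : Param d} (hθ : θ ∈ Θ)
    (y y' : ℕ → ℕ) :
    ‖f θ y - f θ y'‖ₑ ≤ ∑' k, (α 0 k : ℝ≥0∞) * (Nat.dist (y k) (y' k) : ℝ≥0∞) := by
  have h := hLip.2.2 0 y y' θ hθ
  -- The derivative of order zero is the value itself, up to a linear isometry.
  have h0 : iteratedFDeriv ℝ ((0 : Fin 3) : ℕ) (fun η => f η y) θ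
      - iteratedFDeriv ℝ ((0 : Fin 3) : ℕ) (fun η => f η y') θ
      = (continuousMultilinearCurryFin0 ℝ (Param d) ℝ).symm (f θ y - f θ y') := by
    rw [map_sub]; rfl
  rw [h0, LinearIsometryEquiv.enorm_map] at h
  exact h

/-- This is `log x ≤ x - 1` at `x = a / b` and at `x = b / a`. -/
theorem abs_log_sub_log_le {c a b : ℝ} (hc : 0 < c) (ha : c ≤ a) (hb : c ≤ b) :
    |Real.log a - Real.log b| ≤ c⁻¹ * |a - b| := by
  have key : ∀ a b : ℝ, c ≤ a → c ≤ b → Real.log a - Real.log b ≤ c⁻¹ * |a - b| := by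
    intro a b ha hb
    have hb0 : 0 < b := hc.trans_le hb
    have ha0 : 0 < a := hc.trans_le ha
    rw [← Real.log_div ha0.ne' hb0.ne']
    calc Real.log (a / b) ≤ a / b - 1 := Real.log_le_sub_one_of_pos (by positivity)
      _ = b⁻¹ * (a - b) := by field_simp
      _ ≤ b⁻¹ * |a - b| := by gcongr; exact le_abs_self _
      _ ≤ c⁻¹ * |a - b| := by gcongr
  rw [abs_sub_le_iff]
  refine ⟨key a b ha hb, ?_⟩
  rw [abs_sub_comm]
  exact key b a hb ha

omit [MeasurableSpace Ω] in
theorem enorm_ellHat_sub_ell_le (hLip : LipschitzCondition f Θ α) {c : ℝ} (hc : 0 < c)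
    (hlow : ∀ θ ∈ Θ, ∀ y, c ≤ f θ y) {θ : Param d} (hθ : θ ∈ Θ) (t : ℤ) (ω : Ω) :
    ‖ellHat f Y t ω θ - ell f Y t ω θ‖ₑ
      ≤ (1 + ENNReal.ofReal c⁻¹ * (Y t ω : ℝ≥0∞)) * pastErr α Y t ω := by
  have h1 := enorm_sub_le_of_lipschitz hLip hθ (obsPast Y t ω) (past Y t ω)
  have h2 : |ellHat f Y t ω θ - ell f Y t ω θ|
      ≤ (1 + c⁻¹ * (Y t ω : ℝ)) * |f θ (obsPast Y t ω) - f θ (past Y t ω)| := by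
    have h3 := abs_log_sub_log_le hc (hlow θ hθ (obsPast Y t ω)) (hlow θ hθ (past Y t ω))
    have h4 : ellHat f Y t ω θ - ell f Y t ω θ
        = (Y t ω : ℝ) * (Real.log (f θ (obsPast Y t ω)) - Real.log (f θ (past Y t ω)))
          - (f θ (obsPast Y t ω) - f θ (past Y t ω)) := by
      simp only [ellHat, ell, lamHat, lam]; ring
    rw [h4]
    refine (abs_sub _ _).trans ?_
    rw [abs_mul, Nat.abs_cast]
    have := mul_le_mul_of_nonneg_left h3 (Nat.cast_nonneg (α := ℝ) (Y t ω))
    linarith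
  calc ‖ellHat f Y t ω θ - ell f Y t ω θ‖ₑ
      ≤ ENNReal.ofReal ((1 + c⁻¹ * (Y t ω : ℝ)) * |f θ (obsPast Y t ω) - f θ (past Y t ω)|) := by
        rw [Real.enorm_eq_ofReal_abs]; exact ENNReal.ofReal_le_ofReal h2
    _ = (1 + ENNReal.ofReal c⁻¹ * (Y t ω : ℝ≥0∞)) * ‖f θ (obsPast Y t ω) - f θ (past Y t ω)‖ₑ := by
        rw [ENNReal.ofReal_mul (by positivity), Real.enorm_eq_ofReal_abs,
          ENNReal.ofReal_add (by norm_num) (by positivity), ENNReal.ofReal_mul (by positivity)]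
        simp
    _ ≤ _ := by gcongr; exact h1

theorem measurable_pastErr (hY : ∀ t, Measurable (Y t)) (t : ℤ) : Measurable (pastErr α Y t) := by
  have h3 : Measurable fun p : ℕ × ℕ => ((Nat.dist p.1 p.2 : ℕ) : ℝ≥0∞) :=
    measurable_of_countable _
  have h1 : ∀ k, Measurable fun ω => obsPast Y t ω k := fun k => by
    by_cases h : 1 ≤ t - 1 - (k : ℤ)
    · simpa only [obsPast, if_pos h] using hY (t - 1 - k)
    · simp only [obsPast, if_neg h, measurable_const]
  have h2 : ∀ k, Measurable fun ω => past Y t ω k := fun k => hY (t - 1 - k)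
  have h4 : ∀ k, Measurable fun ω => (α 0 k : ℝ≥0∞) *
      ((Nat.dist (obsPast Y t ω k) (past Y t ω k) : ℕ) : ℝ≥0∞) := fun k =>
    (h3.comp ((h1 k).prodMk (h2 k))).const_mul _
  exact Measurable.tsum h4

/-- The logarithmic part of the likelihood multiplies past errors by `Y_t`, so products of two
counts must be integrated; `k l ≤ k² + l²` reduces them to second moments. -/
theorem lintegral_weight_mul_le {C : ℝ≥0} (hY : ∀ t, Measurable (Y t))
    (hC : ∀ t, ∫⁻ ω, (Y t ω : ℝ≥0∞) ^ 2 ∂μ ≤ C) (b : ℝ≥0∞) (s t : ℤ) :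
    ∫⁻ ω, (1 + b * (Y t ω : ℝ≥0∞)) * (Y s ω : ℝ≥0∞) ∂μ ≤ (1 + 2 * b) * C := by
  have hm : ∀ t, Measurable fun ω => (Y t ω : ℝ≥0∞) := fun t => measurable_from_top.comp (hY t)
  have hsq : ∀ k : ℕ, (k : ℝ≥0∞) ≤ (k : ℝ≥0∞) ^ 2 := fun k => by
    exact_mod_cast Nat.le_self_pow two_ne_zero k
  have hpr : ∀ k l : ℕ, (k : ℝ≥0∞) * l ≤ (k : ℝ≥0∞) ^ 2 + (l : ℝ≥0∞) ^ 2 := fun k l => by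
    have : k * l ≤ k ^ 2 + l ^ 2 := by nlinarith [sq_nonneg ((k : ℤ) - l), Nat.zero_le (k * l)]
    exact_mod_cast this
  calc ∫⁻ ω, (1 + b * (Y t ω : ℝ≥0∞)) * (Y s ω : ℝ≥0∞) ∂μ
      ≤ ∫⁻ ω, ((Y s ω : ℝ≥0∞) ^ 2 + b * ((Y t ω : ℝ≥0∞) ^ 2 + (Y s ω : ℝ≥0∞) ^ 2)) ∂μ := by
        refine lintegral_mono fun ω => ?_
        rw [add_mul, one_mul, mul_assoc]
        gcongr
        · exact hsq _
        · exact hpr _ _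
    _ = ∫⁻ ω, (Y s ω : ℝ≥0∞) ^ 2 ∂μ
        + b * (∫⁻ ω, (Y t ω : ℝ≥0∞) ^ 2 ∂μ + ∫⁻ ω, (Y s ω : ℝ≥0∞) ^ 2 ∂μ) := by
        rw [lintegral_add_left ((hm s).pow_const 2), lintegral_const_mul _
          (by exact ((hm t).pow_const 2).add ((hm s).pow_const 2)),
          lintegral_add_left ((hm t).pow_const 2)]
    _ ≤ (C + b * (C + C) : ℝ≥0∞) := by gcongr <;> exact hC _
    _ = (1 + 2 * b) * C := by ring

/-- At time `l + 1` the lags `1, …, l`, that is the indices `k < l`, are observed and contribute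
nothing. Only the tail of `α 0` from index `l` on remains. -/
theorem lintegral_weight_mul_pastErr_le {C : ℝ≥0} (hY : ∀ t, Measurable (Y t))
    (hC : ∀ t, ∫⁻ ω, (Y t ω : ℝ≥0∞) ^ 2 ∂μ ≤ C) (b : ℝ≥0∞) (l : ℕ) :
    ∫⁻ ω, (1 + b * (Y (l + 1 : ℕ) ω : ℝ≥0∞)) * pastErr α Y (l + 1 : ℕ) ω ∂μ
      ≤ (1 + 2 * b) * C * ∑' k, (α 0 (l + k) : ℝ≥0∞) := by
  have hm : ∀ t, Measurable fun ω => (Y t ω : ℝ≥0∞) := fun t => measurable_from_top.comp (hY t)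
  have hpt : ∀ ω, pastErr α Y (l + 1 : ℕ) ω
      ≤ ∑' k, (α 0 (l + k) : ℝ≥0∞) * (Y (-k) ω : ℝ≥0∞) := by
    intro ω
    rw [pastErr, ← ENNReal.summable.sum_add_tsum_nat_add' (k := l), Finset.sum_eq_zero, zero_add]
    · refine ENNReal.tsum_le_tsum fun k => ?_
      have e1 : obsPast Y (l + 1 : ℕ) ω (k + l) = 0 := if_neg (by push_cast; omega)
      have e2 : past Y (l + 1 : ℕ) ω (k + l) = Y (-k) ω := by
        simp only [past]; congr 1; push_cast; ring
      rw [e1, e2, add_comm k l]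
      simp [Nat.dist]
    · intro k hk
      have hk' : k < l := Finset.mem_range.1 hk
      have e1 : obsPast Y (l + 1 : ℕ) ω k = past Y (l + 1 : ℕ) ω k := if_pos (by push_cast; omega)
      rw [e1, Nat.dist_self]; simp
  calc ∫⁻ ω, (1 + b * (Y (l + 1 : ℕ) ω : ℝ≥0∞)) * pastErr α Y (l + 1 : ℕ) ω ∂μ
      ≤ ∫⁻ ω, ∑' k : ℕ, (α 0 (l + k) : ℝ≥0∞) *
          ((1 + b * (Y (l + 1 : ℕ) ω : ℝ≥0∞)) * (Y (-k) ω : ℝ≥0∞)) ∂μ := by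
        refine lintegral_mono fun ω => (mul_le_mul_right (hpt ω) _).trans ?_
        rw [← ENNReal.tsum_mul_left]
        exact ENNReal.tsum_le_tsum fun k => (by ring_nf; exact le_rfl)
    _ = ∑' k : ℕ, (α 0 (l + k) : ℝ≥0∞) *
          ∫⁻ ω, (1 + b * (Y (l + 1 : ℕ) ω : ℝ≥0∞)) * (Y (-k) ω : ℝ≥0∞) ∂μ := by
        rw [lintegral_tsum fun k => by
          exact (((((hm _).const_mul b).const_add 1).mul (hm _)).const_mul _).aemeasurable]
        refine tsum_congr fun k => lintegral_const_mul _
          ((((hm _).const_mul b).const_add 1).mul (hm _))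
    _ ≤ ∑' k : ℕ, (α 0 (l + k) : ℝ≥0∞) * ((1 + 2 * b) * C) := by
        gcongr with k
        exact lintegral_weight_mul_le hY hC b _ _
    _ = _ := by rw [ENNReal.tsum_mul_right, mul_comm]

/-- The quasi-log-likelihood computed from the whole past. -/
noncomputable def LFull (f : Param d → (ℕ → ℕ) → ℝ) (Y : ℤ → Ω → ℕ) (n : ℕ) (ω : Ω)
    (θ : Param d) : ℝ :=
  ∑ l ∈ Finset.range n, ell f Y (l + 1 : ℕ) ω θ

omit [MeasurableSpace Ω] in
theorem LHat_eq_sum_range (n : ℕ) (ω : Ω) (θ : Param d) :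
    LHat f Y n ω θ = ∑ l ∈ Finset.range n, ellHat f Y (l + 1 : ℕ) ω θ := by
  rw [LHat, Finset.range_eq_Ico, Finset.sum_Ico_add' (fun t : ℕ => ellHat f Y (t : ℤ) ω θ) 0 n 1]
  rfl

/-- Replacing the unobserved past by zeros changes the quasi-log-likelihood by `o(κ_n)`, uniformly
in the parameter. -/
theorem tendsto_measure_LHat_sub_LFull {κ : ℕ → ℝ} (hY : ∀ t, Measurable (Y t))
    (hmom : MomentCondition μ Y) (hLip : LipschitzCondition f Θ α) {c : ℝ} (hc : 0 < c)
    (hlow : ∀ θ ∈ Θ, ∀ y, c ≤ f θ y) (hκ : PenaltyCondition κ α) {ε : ℝ} (hε : 0 < ε) :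
    Tendsto (fun n => μ {ω | ∃ θ ∈ Θ, ε * κ n ≤ |LHat f Y n ω θ - LFull f Y n ω θ|})
      atTop (𝓝 0) := by
  obtain ⟨C, hC⟩ := exists_lintegral_sq_le hmom
  obtain ⟨hmono, hκt, -, hsum⟩ := hκ
  set b := ENNReal.ofReal c⁻¹ with hb
  set D : ℕ → Ω → ℝ≥0∞ := fun l ω =>
    (1 + b * (Y (l + 1 : ℕ) ω : ℝ≥0∞)) * pastErr α Y (l + 1 : ℕ) ω with hD
  have hDm : ∀ l, Measurable (D l) := fun l =>
    ((((measurable_from_top (f := fun k : ℕ => (k : ℝ≥0∞))).comp (hY _)).const_mul b).const_add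
      1).mul (measurable_pastErr hY _)
  set x : ℕ → ℝ := fun l => ∑' k : ℕ, (α 0 (l + k) : ℝ) with hx
  have hxe : ∀ l, ∑' k, (α 0 (l + k) : ℝ≥0∞) = ENNReal.ofReal (x l) := by
    intro l
    have hs : Summable fun k => α 0 (l + k) := by
      simpa [add_comm] using (NNReal.summable_nat_add_iff l).2 (hLip.1 0)
    rw [← ENNReal.coe_tsum hs, hx]
    simp only
    rw [← NNReal.coe_tsum, ENNReal.ofReal_coe_nnreal]
  have hx0 : ∀ l, 0 ≤ x l := fun l => tsum_nonneg fun k => NNReal.coe_nonneg _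
  have hK := tendsto_inv_mul_sum_range hmono hκt hx0 (hsum 0)
  set A := (1 + 2 * b) * (C : ℝ≥0∞) with hA
  have hAtop : A ≠ ∞ := by
    refine ENNReal.mul_ne_top (ENNReal.add_ne_top.2 ⟨by simp, ENNReal.mul_ne_top (by simp) ?_⟩)
      ENNReal.coe_ne_top
    exact ENNReal.ofReal_ne_top
  -- This is the bound that Markov's inequality will give. It vanishes because the accumulated tails
  -- of `α 0` are `o(κ_n)`.
  have hbound : Tendsto (fun n => A * ENNReal.ofReal (ε⁻¹ * ((κ n)⁻¹ * ∑ l ∈ Finset.range n, x l)))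
      atTop (𝓝 0) := by
    have h1 := ENNReal.tendsto_ofReal (hK.const_mul ε⁻¹)
    have h2 := ENNReal.Tendsto.const_mul (a := A) h1 (Or.inr hAtop)
    simpa using h2
  refine tendsto_of_tendsto_of_tendsto_of_le_of_le' tendsto_const_nhds hbound
    (Eventually.of_forall fun n => zero_le) ?_
  filter_upwards [hκt.eventually_gt_atTop 0] with n hn
  have hpos : 0 < ε * κ n := mul_pos hε hn
  calc μ {ω | ∃ θ ∈ Θ, ε * κ n ≤ |LHat f Y n ω θ - LFull f Y n ω θ|}
      ≤ μ {ω | ENNReal.ofReal (ε * κ n) ≤ ∑ l ∈ Finset.range n, D l ω} := by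
        refine measure_mono ?_
        rintro ω ⟨θ, hθ, h⟩
        refine (ENNReal.ofReal_le_ofReal h).trans ?_
        rw [← Real.enorm_eq_ofReal_abs, LHat_eq_sum_range, LFull, ← Finset.sum_sub_distrib]
        refine (enorm_sum_le _ _).trans (Finset.sum_le_sum fun l _ => ?_)
        exact enorm_ellHat_sub_ell_le hLip hc hlow hθ _ ω
    _ ≤ (∫⁻ ω, ∑ l ∈ Finset.range n, D l ω ∂μ) / ENNReal.ofReal (ε * κ n) :=
        meas_ge_le_lintegral_div (Finset.measurable_sum _ fun l _ => hDm l).aemeasurable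
          (by simpa using hpos) ENNReal.ofReal_ne_top
    _ ≤ (∑ l ∈ Finset.range n, A * ENNReal.ofReal (x l)) / ENNReal.ofReal (ε * κ n) := by
        rw [lintegral_finsetSum _ fun l _ => hDm l]
        gcongr with l
        rw [← hxe]
        exact lintegral_weight_mul_pastErr_le hY hC b l
    _ = A * ENNReal.ofReal (ε⁻¹ * ((κ n)⁻¹ * ∑ l ∈ Finset.range n, x l)) := by
        rw [← Finset.mul_sum, ← ENNReal.ofReal_sum_of_nonneg fun l _ => hx0 l, mul_div_assoc,
          ← ENNReal.ofReal_div_of_pos hpos]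
        congr 2
        field_simp

end CountProcess

/-! ### Integration against weights measurable for the conditioning σ-field -/

section CondExp

variable {Ω : Type*} {m m0 : MeasurableSpace Ω} {μ : Measure Ω} [IsFiniteMeasure μ]

/-- A nonnegative variable is integrable against a weight that is measurable for the conditioning
σ-field as soon as its conditional expectation is. -/
theorem integrable_mul_of_condExp_mul (hm : m ≤ m0) {X W : Ω → ℝ} (hX : Integrable X μ)
    (hX0 : ∀ ω, 0 ≤ X ω) (hW : Measurable[m] W)
    (hi : Integrable (fun ω => (μ[X|m]) ω * W ω) μ) : Integrable (fun ω => X ω * W ω) μ := by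
  have hA0 : 0 ≤ᵐ[μ] μ[X|m] := condExp_nonneg (ae_of_all _ hX0)
  -- The measures with densities `X` and `μ[X|m]` agree on `m`, so the `m`-measurable function
  -- `‖W‖ₑ` has the same integral under both. No prior integrability of `X W` is required.
  have htrim : (μ.withDensity fun ω => ENNReal.ofReal (X ω)).trim hm
      = (μ.withDensity fun ω => ENNReal.ofReal ((μ[X|m]) ω)).trim hm := by
    refine @Measure.ext _ m _ _ fun s hs => ?_
    rw [trim_measurableSet_eq hm hs, trim_measurableSet_eq hm hs,
      withDensity_apply _ (hm s hs), withDensity_apply _ (hm s hs),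
      ← ofReal_integral_eq_lintegral_ofReal hX.integrableOn (ae_of_all _ hX0),
      ← ofReal_integral_eq_lintegral_ofReal integrable_condExp.integrableOn
        (ae_restrict_of_ae hA0), setIntegral_condExp hm hX hs]
  have hWe : Measurable[m] fun ω => ‖W ω‖ₑ := measurable_enorm.comp hW
  have key : ∀ Z : Ω → ℝ, Integrable Z μ → 0 ≤ᵐ[μ] Z → ∫⁻ ω, ‖Z ω * W ω‖ₑ ∂μ
      = ∫⁻ ω, ‖W ω‖ₑ ∂((μ.withDensity fun ω => ENNReal.ofReal (Z ω)).trim hm) := by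
    intro Z hZ hZ0
    rw [lintegral_trim hm hWe, lintegral_withDensity_eq_lintegral_mul₀
      hZ.aemeasurable.ennreal_ofReal (hWe.mono hm le_rfl).aemeasurable]
    refine lintegral_congr_ae ?_
    filter_upwards [hZ0] with ω h0
    rw [enorm_mul, Real.enorm_of_nonneg h0]; rfl
  refine ⟨hX.1.mul (hW.mono hm le_rfl).aestronglyMeasurable, ?_⟩
  have h2 := hi.2
  rw [hasFiniteIntegral_iff_enorm] at h2 ⊢
  rwa [key X hX (ae_of_all _ hX0), htrim, ← key _ integrable_condExp hA0]

omit [IsFiniteMeasure μ] in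
theorem condExp_mul_eq {X W : Ω → ℝ} (hX : Integrable X μ)
    (hW : Measurable[m] W) (hi : Integrable (fun ω => X ω * W ω) μ) :
    μ[fun ω => X ω * W ω|m] =ᵐ[μ] fun ω => (μ[X|m]) ω * W ω :=
  condExp_mul_of_stronglyMeasurable_right hW.stronglyMeasurable hi hX

theorem integral_mul_eq_integral_condExp_mul (hm : m ≤ m0) {X W : Ω → ℝ} (hX : Integrable X μ)
    (hW : Measurable[m] W) (hi : Integrable (fun ω => X ω * W ω) μ) :
    ∫ ω, X ω * W ω ∂μ = ∫ ω, (μ[X|m]) ω * W ω ∂μ := by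
  rw [← integral_condExp hm]
  exact integral_congr_ae (condExp_mul_eq hX hW hi)

end CondExp

/-! ### The past σ-field and transfer to the canonical process -/

section CountProcess

variable {Ω : Type*} [MeasurableSpace Ω] {μ : Measure Ω} {Y : ℤ → Ω → ℕ}

theorem pastSigma_le (hY : ∀ t, Measurable (Y t)) (t : ℤ) : pastSigma Y t ≤ ‹MeasurableSpace Ω› :=
  iSup₂_le fun s _ => (hY s).comap_le

omit [MeasurableSpace Ω] in
theorem measurable_pastSigma {s t : ℤ} (h : s < t) : Measurable[pastSigma Y t] (Y s) :=
  Measurable.mono (comap_measurable (Y s))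
    (le_iSup₂ (f := fun (s : ℤ) (_ : s < t) => MeasurableSpace.comap (Y s) inferInstance) s h)
    le_rfl

omit [MeasurableSpace Ω] in
theorem measurable_past_pastSigma {r t : ℤ} (h : r ≤ t) : Measurable[pastSigma Y t] (past Y r) :=
  (@measurable_pi_iff _ _ _ (pastSigma Y t) _ _).2 fun k => measurable_pastSigma (by omega)

theorem measurable_past (hY : ∀ t, Measurable (Y t)) (t : ℤ) : Measurable (past Y t) :=
  measurable_pi_iff.2 fun _ => hY _

theorem memLp_two_count (hY : ∀ t, Measurable (Y t)) (hmom : MomentCondition μ Y) (t : ℤ) :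
    MemLp (fun ω => (Y t ω : ℝ)) 2 μ := by
  obtain ⟨C, hC⟩ := exists_lintegral_sq_le hmom
  have hm : Measurable fun ω => (Y t ω : ℝ) := measurable_from_top.comp (hY t)
  refine (memLp_two_iff_integrable_sq hm.aestronglyMeasurable).2
    ⟨(hm.pow_const 2).aestronglyMeasurable, ?_⟩
  rw [hasFiniteIntegral_iff_enorm]
  refine lt_of_eq_of_lt (lintegral_congr fun ω => ?_) ((hC t).trans_lt ENNReal.coe_lt_top)
  rw [enorm_pow]
  simp

/-! ### The canonical process -/

/-- The left shift on two-sided sequences. -/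
def shift (x : ℤ → ℕ) (t : ℤ) : ℕ := x (t + 1)

/-- The coordinate process on two-sided sequences. -/
def coord (t : ℤ) (x : ℤ → ℕ) : ℕ := x t

/-- The path `t ↦ Y_{t+s}`. -/
def path (Y : ℤ → Ω → ℕ) (s : ℤ) (ω : Ω) (t : ℤ) : ℕ := Y (t + s) ω

/-- The law of the process. -/
noncomputable def law (μ : Measure Ω) (Y : ℤ → Ω → ℕ) : Measure (ℤ → ℕ) := μ.map (path Y 0)

omit [MeasurableSpace Ω] in
theorem shift_path (s : ℤ) (ω : Ω) : shift (path Y s ω) = path Y (s + 1) ω := by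
  ext t; simp only [shift, path]; congr 1; ring

omit [MeasurableSpace Ω] in
theorem shift_iterate_path (s : ℤ) (n : ℕ) (ω : Ω) :
    shift^[n] (path Y s ω) = path Y (s + n) ω := by
  induction n with
  | zero => simp
  | succ n ih => rw [Function.iterate_succ_apply', ih, shift_path]; push_cast; congr 1; ring

omit [MeasurableSpace Ω] in
theorem past_coord_path (s : ℤ) (ω : Ω) : past coord 0 (path Y s ω) = past Y s ω := by
  ext k; simp only [past, coord, path]; congr 1; ring

omit [MeasurableSpace Ω] in
theorem coord_path (s : ℤ) (ω : Ω) : coord 0 (path Y s ω) = Y s ω := by simp [coord, path]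

theorem measurable_coord (t : ℤ) : Measurable (coord t) := measurable_pi_apply t

theorem measurable_path (hY : ∀ t, Measurable (Y t)) (s : ℤ) : Measurable (path Y s) :=
  measurable_pi_iff.2 fun _ => hY _

/-- Ergodicity concerns the shift on `ℕ^ℤ`, not a map of `Ω`. Time averages are therefore studied
under the law of the process and pulled back along `path`. -/
theorem ergodic_shift (hstat : StationaryErgodic μ Y) : Ergodic shift (law μ Y) := by
  have : path Y 0 = fun ω t => Y t ω := by ext ω t; simp [path]
  rw [law, this]
  exact hstat.2

theorem measurePreserving_path (hstat : StationaryErgodic μ Y) (n : ℕ) :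
    MeasurePreserving (path Y n) μ (law μ Y) := by
  have h0 : MeasurePreserving (path Y 0) μ (law μ Y) := ⟨measurable_path hstat.1 0, rfl⟩
  have h1 := ((ergodic_shift hstat).toMeasurePreserving.iterate n).comp h0
  have h2 : shift^[n] ∘ path Y 0 = path Y n := by
    ext1 ω; simp [shift_iterate_path]
  rwa [h2] at h1

theorem isProbabilityMeasure_law [IsProbabilityMeasure μ] (hstat : StationaryErgodic μ Y) :
    IsProbabilityMeasure (law μ Y) :=
  Measure.isProbabilityMeasure_map (measurable_path hstat.1 0).aemeasurable

/-- Events of vanishing probability for the canonical process, pulled back. -/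
theorem tendsto_measure_of_path (hstat : StationaryErgodic μ Y) (s : ℕ) {A : ℕ → Set (ℤ → ℕ)}
    {B : ℕ → Set Ω} (hA : Tendsto (fun n => law μ Y (A n)) atTop (𝓝 0))
    (hB : ∀ᶠ n in atTop, ∀ ω ∈ B n, path Y s ω ∈ A n) :
    Tendsto (fun n => μ (B n)) atTop (𝓝 0) := by
  refine tendsto_of_tendsto_of_tendsto_of_le_of_le' tendsto_const_nhds hA
    (Eventually.of_forall fun n => zero_le) ?_
  filter_upwards [hB] with n hn
  have hp := measurePreserving_path hstat s
  rw [← hp.map_eq]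
  -- This inequality for the image measure holds for arbitrary sets; events quantified over
  -- uncountably many parameters need not be shown measurable.
  exact (measure_mono hn).trans (Measure.le_map_apply hp.measurable.aemeasurable _)

end CountProcess

/-! ### Separation of the true parameter from distant ones -/

section Consistency

variable {Ω : Type*} [MeasurableSpace Ω] {μ : Measure Ω} {d : ℕ}
  {f : Param d → (ℕ → ℕ) → ℝ} {Y : ℤ → Ω → ℕ} {U Θ : Set (Param d)} {α : Fin 3 → ℕ → ℝ≥0}
  {θs : Param d}

omit [MeasurableSpace Ω] in
theorem ell_eq_quasiLog (t : ℤ) (ω : Ω) :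
    ell f Y t ω = quasiLog (Y t ω) (fun θ => f θ (past Y t ω)) := rfl

omit [MeasurableSpace Ω] in
theorem ell_coord_path (s : ℤ) (ω : Ω) : ell f coord 0 (path Y s ω) = ell f Y s ω := by
  rw [ell_eq_quasiLog, ell_eq_quasiLog, coord_path, past_coord_path]

omit [MeasurableSpace Ω] in
-- The path starts at time `1` because the sum runs over `Y_1, …, Y_n`: the `l`-th shift has
-- `Y_{l+1}` at coordinate `0`.
theorem LFull_eq_birkhoffSum (n : ℕ) (ω : Ω) (θ : Param d) :
    LFull f Y n ω θ = birkhoffSum shift (fun x => ell f coord 0 x θ) n (path Y 1 ω) := by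
  refine Finset.sum_congr rfl fun l _ => ?_
  have h : (1 : ℤ) + l = (l + 1 : ℕ) := by push_cast; ring
  rw [shift_iterate_path, h]
  simp only [ell_coord_path]

theorem measurable_ell (hY : ∀ t, Measurable (Y t)) (t : ℤ) {θ : Param d}
    (hθ : Measurable (f θ)) : Measurable fun ω => ell f Y t ω θ := by
  have h1 : Measurable fun ω => (Y t ω : ℝ) := measurable_from_top.comp (hY t)
  have h2 : Measurable fun ω => lam f Y t ω θ := hθ.comp (measurable_past hY t)
  exact (h1.mul h2.log).sub h2

/-- An integrable bound for the quasi-log-likelihood of one observation and its terms. -/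
theorem exists_lintegral_bound [IsProbabilityMeasure μ] (hY : ∀ t, Measurable (Y t))
    (hmom : MomentCondition μ Y)
    (hΘ : IsCompact Θ) (hA2 : SmoothFamily f U Θ) (hLip : LipschitzCondition f Θ α) {c : ℝ}
    (hc : 0 < c) (hlow : ∀ θ ∈ Θ, ∀ y, c ≤ f θ y) (t : ℤ) :
    ∃ G : Ω → ℝ≥0∞, ∫⁻ ω, G ω ∂μ < ∞ ∧ ∀ θ ∈ Θ, ∀ ω,
      ‖(Y t ω : ℝ) * Real.log (lam f Y t ω θ)‖ₑ ≤ G ω ∧ ‖lam f Y t ω θ‖ₑ ≤ G ω ∧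
      ‖ell f Y t ω θ‖ₑ ≤ G ω := by
  obtain ⟨C, hC⟩ := exists_lintegral_sq_le hmom
  -- Compactness bounds `f_θ` at the zero sequence, and the Lipschitz condition then bounds the mean
  -- by a weighted sum of past counts, uniformly in `θ`.
  obtain ⟨B, hB⟩ := hΘ.exists_bound_of_continuousOn
    (((hA2.2.2.2 0).continuousOn).mono hA2.2.1)
  set b := ENNReal.ofReal c⁻¹ with hb
  have hbtop : b ≠ ∞ := ENNReal.ofReal_ne_top
  set Λ : Ω → ℝ≥0∞ := fun ω => ENNReal.ofReal B + ∑' k, (α 0 k : ℝ≥0∞) * (past Y t ω k : ℝ≥0∞)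
    with hΛ
  have hlamΛ : ∀ θ ∈ Θ, ∀ ω, ‖lam f Y t ω θ‖ₑ ≤ Λ ω := by
    intro θ hθ ω
    have h1 := enorm_sub_le_of_lipschitz hLip hθ (past Y t ω) 0
    have h2 : lam f Y t ω θ = f θ 0 + (f θ (past Y t ω) - f θ 0) := by simp [lam]
    rw [h2]
    refine (enorm_add_le _ _).trans (add_le_add ?_ (h1.trans (le_of_eq ?_)))
    · rw [Real.enorm_eq_ofReal_abs]; exact ENNReal.ofReal_le_ofReal (hB θ hθ)
    · simp [Nat.dist]
  have hm : ∀ t, Measurable fun ω => (Y t ω : ℝ≥0∞) := fun t => measurable_from_top.comp (hY t)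
  have hw : Measurable fun ω => 1 + b * (Y t ω : ℝ≥0∞) := ((hm t).const_mul b).const_add 1
  have hYi : ∫⁻ ω, (Y t ω : ℝ≥0∞) ∂μ ≤ C := 
    (lintegral_mono fun ω => (by exact_mod_cast Nat.le_self_pow two_ne_zero (Y t ω) :
      (Y t ω : ℝ≥0∞) ≤ (Y t ω : ℝ≥0∞) ^ 2)).trans (hC t)
  refine ⟨fun ω => ‖Real.log c‖ₑ * (Y t ω : ℝ≥0∞) + (1 + b * (Y t ω : ℝ≥0∞)) * Λ ω, ?_, ?_⟩
  · rw [lintegral_add_left ((hm t).const_mul _), lintegral_const_mul _ (hm t)]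
    refine ENNReal.add_lt_top.2 ⟨ENNReal.mul_lt_top enorm_lt_top
      (hYi.trans_lt ENNReal.coe_lt_top), ?_⟩
    have h1 : ∀ ω, (1 + b * (Y t ω : ℝ≥0∞)) * Λ ω = (1 + b * (Y t ω : ℝ≥0∞)) * ENNReal.ofReal B
        + ∑' k : ℕ, (α 0 k : ℝ≥0∞) * ((1 + b * (Y t ω : ℝ≥0∞)) * (Y (t - 1 - k) ω : ℝ≥0∞)) := by
      intro ω
      rw [hΛ]; simp only
      rw [mul_add, ← ENNReal.tsum_mul_left]
      congr 1
      exact tsum_congr fun k => by simp only [past]; ring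
    simp_rw [h1]
    rw [lintegral_add_left (hw.mul_const _), lintegral_mul_const _ hw,
      lintegral_add_left measurable_const, lintegral_const_mul _ (hm t),
      lintegral_tsum fun k => by exact ((hw.mul (hm _)).const_mul _).aemeasurable]
    refine ENNReal.add_lt_top.2 ⟨ENNReal.mul_lt_top (ENNReal.add_lt_top.2 ⟨by simp,
      ENNReal.mul_lt_top hbtop.lt_top (hYi.trans_lt ENNReal.coe_lt_top)⟩)
      ENNReal.ofReal_lt_top, ?_⟩
    calc ∑' k : ℕ, ∫⁻ ω, (α 0 k : ℝ≥0∞) *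
          ((1 + b * (Y t ω : ℝ≥0∞)) * (Y (t - 1 - k) ω : ℝ≥0∞)) ∂μ
        ≤ ∑' k : ℕ, (α 0 k : ℝ≥0∞) * ((1 + 2 * b) * C) := by
          refine ENNReal.tsum_le_tsum fun k => ?_
          rw [lintegral_const_mul _ (by exact hw.mul (hm _))]
          gcongr
          exact lintegral_weight_mul_le hY hC b _ _
      _ < ∞ := by
          rw [ENNReal.tsum_mul_right]
          refine ENNReal.mul_lt_top (ENNReal.tsum_coe_ne_top_iff_summable.2 (hLip.1 0)).lt_top
            (ENNReal.mul_lt_top (ENNReal.add_lt_top.2 ⟨by simp,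
              ENNReal.mul_lt_top (by simp) hbtop.lt_top⟩) ENNReal.coe_lt_top)
  · intro θ hθ ω
    have hl := hlow θ hθ (past Y t ω)
    have hL := hlamΛ θ hθ ω
    have h0 : 0 < lam f Y t ω θ := hc.trans_le hl
    have h1 : ‖(Y t ω : ℝ) * Real.log (lam f Y t ω θ)‖ₑ
        ≤ ‖Real.log c‖ₑ * (Y t ω : ℝ≥0∞) + b * (Y t ω : ℝ≥0∞) * Λ ω := by
      have h2 : |Real.log (lam f Y t ω θ)| ≤ |Real.log c| + c⁻¹ * lam f Y t ω θ := by
        have h3 := abs_log_sub_log_le hc hl le_rfl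
        have h4 := abs_sub_abs_le_abs_sub (Real.log (f θ (past Y t ω))) (Real.log c)
        have h5 : c⁻¹ * |f θ (past Y t ω) - c| ≤ c⁻¹ * lam f Y t ω θ := by
          gcongr
          rw [abs_of_nonneg (by linarith)]
          simp only [lam]; linarith
        simp only [lam] at *
        linarith
      have h3 : ‖Real.log (lam f Y t ω θ)‖ₑ ≤ ‖Real.log c‖ₑ + b * ‖lam f Y t ω θ‖ₑ := by
        rw [Real.enorm_eq_ofReal_abs, Real.enorm_eq_ofReal_abs, Real.enorm_of_nonneg h0.le, hb,
          ← ENNReal.ofReal_mul (by positivity), ← ENNReal.ofReal_add (by positivity)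
          (by positivity)]
        exact ENNReal.ofReal_le_ofReal h2
      rw [enorm_mul]
      have h4 : ‖(Y t ω : ℝ)‖ₑ = (Y t ω : ℝ≥0∞) := by simp
      rw [h4]
      calc (Y t ω : ℝ≥0∞) * ‖Real.log (lam f Y t ω θ)‖ₑ
          ≤ (Y t ω : ℝ≥0∞) * (‖Real.log c‖ₑ + b * Λ ω) := by
            gcongr; exact h3.trans (by gcongr)
        _ = _ := by ring
    have hG : (fun ω => ‖Real.log c‖ₑ * (Y t ω : ℝ≥0∞) + (1 + b * (Y t ω : ℝ≥0∞)) * Λ ω) ω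
        = (‖Real.log c‖ₑ * (Y t ω : ℝ≥0∞) + b * (Y t ω : ℝ≥0∞) * Λ ω) + Λ ω := by
      simp only; ring
    rw [hG]
    exact ⟨h1.trans le_self_add, hL.trans le_add_self, enorm_sub_le.trans (add_le_add h1 hL)⟩

theorem integrable_of_enorm_le {g : Ω → ℝ} {G : Ω → ℝ≥0∞} (hg : Measurable g)
    (hG : ∫⁻ ω, G ω ∂μ < ∞) (h : ∀ ω, ‖g ω‖ₑ ≤ G ω) : Integrable g μ :=
  ⟨hg.aestronglyMeasurable, (lintegral_mono h).trans_lt hG⟩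

/-- The expected quasi-log-likelihood is maximal at the true parameter only. -/
theorem integral_ell_lt [IsProbabilityMeasure μ] {p : ℝ → PMF ℕ} (hY : ∀ t, Measurable (Y t))
    (hOD : IsOD μ p (f θs) Y) (hmom : MomentCondition μ Y)
    (hΘ : IsCompact Θ) (hA0 : Identifiable μ f Y Θ) (hA2 : SmoothFamily f U Θ)
    (hLip : LipschitzCondition f Θ α) (hθs : θs ∈ Θ) {θ : Param d} (hθ : θ ∈ Θ) (hne : θ ≠ θs)
    (t : ℤ) : ∫ ω, ell f Y t ω θ ∂μ < ∫ ω, ell f Y t ω θs ∂μ := by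
  obtain ⟨hid, c, hc, hlow⟩ := hA0
  obtain ⟨G, hG, hdom⟩ := exists_lintegral_bound hY hmom hΘ hA2 hLip hc hlow t
  have hYm : Measurable fun ω => (Y t ω : ℝ) := measurable_from_top.comp (hY t)
  have hYi : Integrable (fun ω => (Y t ω : ℝ)) μ :=
    (memLp_two_count hY hmom t).integrable (by norm_num)
  have hlm : ∀ η ∈ Θ, Measurable fun ω => lam f Y t ω η := fun η hη =>
    (hA2.2.2.1 η (hA2.2.1 hη)).comp (measurable_past hY t)
  have hlm' : ∀ η ∈ Θ, Measurable[pastSigma Y t] fun ω => lam f Y t ω η := fun η hη =>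
    (hA2.2.2.1 η (hA2.2.1 hη)).comp (measurable_past_pastSigma le_rfl)
  have hli : ∀ η ∈ Θ, Integrable (fun ω => lam f Y t ω η) μ := fun η hη =>
    integrable_of_enorm_le (hlm η hη) hG fun ω => (hdom η hη ω).2.1
  have hYl : ∀ η ∈ Θ, Integrable (fun ω => (Y t ω : ℝ) * Real.log (lam f Y t ω η)) μ :=
    fun η hη => integrable_of_enorm_le (hYm.mul (hlm η hη).log) hG fun ω => (hdom η hη ω).1
  have hce := (hOD t).2
  -- Conditioning on the past replaces `Y_t` by its conditional mean `λ_t(θ*)`.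
  have hlog : ∀ η ∈ Θ, ∫ ω, (Y t ω : ℝ) * Real.log (lam f Y t ω η) ∂μ
      = ∫ ω, lam f Y t ω θs * Real.log (lam f Y t ω η) ∂μ := fun η hη => by
    refine (integral_mul_eq_integral_condExp_mul (pastSigma_le hY t) hYi
      (Real.measurable_log.comp (hlm' η hη)) (hYl η hη)).trans (integral_congr_ae ?_)
    filter_upwards [hce] with ω hω
    rw [hω]; rfl
  have hll : ∀ η ∈ Θ, Integrable (fun ω => lam f Y t ω θs * Real.log (lam f Y t ω η)) μ :=
    fun η hη => by
      have h1 : Integrable (μ[fun ω => (Y t ω : ℝ) * Real.log (lam f Y t ω η)|pastSigma Y t]) μ :=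
        integrable_condExp
      refine h1.congr ((condExp_mul_eq hYi (Real.measurable_log.comp (hlm' η hη))
        (hYl η hη)).trans ?_)
      filter_upwards [hce] with ω hω
      simp only [Function.comp_apply]
      rw [hω]; rfl
  -- The Kullback-Leibler divergence between Poisson laws with means `λ_t(θ*)` and `λ_t(θ)`. Its
  -- nonnegativity is `log x ≤ x - 1`, strict unless `x = 1`; the counts need not be Poisson.
  set φ : Ω → ℝ := fun ω => (lam f Y t ω θs * Real.log (lam f Y t ω θs) - lam f Y t ω θs)
    - (lam f Y t ω θs * Real.log (lam f Y t ω θ) - lam f Y t ω θ) with hφ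
  have hφi : Integrable φ μ := ((hll θs hθs).sub (hli θs hθs)).sub ((hll θ hθ).sub (hli θ hθ))
  have hell : ∀ η ∈ Θ, ∫ ω, ell f Y t ω η ∂μ
      = ∫ ω, (lam f Y t ω θs * Real.log (lam f Y t ω η) - lam f Y t ω η) ∂μ := fun η hη => by
    simp only [ell]
    rw [integral_sub (hYl η hη) (hli η hη), hlog η hη, integral_sub (hll η hη) (hli η hη)]
  have hφe : ∫ ω, φ ω ∂μ = ∫ ω, ell f Y t ω θs ∂μ - ∫ ω, ell f Y t ω θ ∂μ := by
    rw [hell θ hθ, hell θs hθs]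
    exact integral_sub ((hll θs hθs).sub (hli θs hθs)) ((hll θ hθ).sub (hli θ hθ))
  have hform : ∀ ω, φ ω = lam f Y t ω θs * ((lam f Y t ω θ / lam f Y t ω θs) - 1
      - Real.log (lam f Y t ω θ / lam f Y t ω θs)) := fun ω => by
    have h1 : 0 < lam f Y t ω θs := hc.trans_le (hlow _ hθs _)
    have h2 : 0 < lam f Y t ω θ := hc.trans_le (hlow _ hθ _)
    rw [Real.log_div h2.ne' h1.ne', hφ]
    field_simp
    ring
  have hφ0 : ∀ ω, 0 ≤ φ ω := fun ω => by
    have h1 : 0 < lam f Y t ω θs := hc.trans_le (hlow _ hθs _)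
    have h2 : 0 < lam f Y t ω θ := hc.trans_le (hlow _ hθ _)
    rw [hform]
    have := Real.log_le_sub_one_of_pos (div_pos h2 h1)
    exact mul_nonneg h1.le (by linarith)
  have hpos : 0 < ∫ ω, φ ω ∂μ := by
    refine lt_of_le_of_ne (integral_nonneg hφ0) fun h => hne (hid θ hθ θs hθs ⟨t, ?_⟩)
    have h0 := (integral_eq_zero_iff_of_nonneg hφ0 hφi).1 h.symm
    filter_upwards [h0] with ω hω
    have h1 : 0 < lam f Y t ω θs := hc.trans_le (hlow _ hθs _)
    have h2 : 0 < lam f Y t ω θ := hc.trans_le (hlow _ hθ _)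
    by_contra hcon
    have h3 : lam f Y t ω θ / lam f Y t ω θs ≠ 1 := fun h => hcon ((div_eq_one_iff_eq h1.ne').1 h)
    have h4 := Real.log_lt_sub_one_of_pos (div_pos h2 h1) h3
    have h5 : 0 < φ ω := by rw [hform]; exact mul_pos h1 (by linarith)
    exact h5.ne' hω
  linarith

/-- Outside a neighbourhood of the true parameter the quasi-log-likelihood is smaller than at the
true parameter by an amount of order `n`, with probability tending to one. -/
theorem exists_tendsto_measure_LFull_far [IsProbabilityMeasure μ] {p : ℝ → PMF ℕ}
    (hstat : StationaryErgodic μ Y)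
    (hOD : IsOD μ p (f θs) Y) (hmom : MomentCondition μ Y)
    (hΘ : IsCompact Θ) (hA0 : Identifiable μ f Y Θ) (hA2 : SmoothFamily f U Θ)
    (hLip : LipschitzCondition f Θ α) (hθs : θs ∈ Θ) {r : ℝ} (hr : 0 < r) :
    ∃ δ : ℝ, 0 < δ ∧ Tendsto (fun n : ℕ => μ {ω | ∃ θ ∈ Θ, r ≤ dist θ θs ∧
      LFull f Y n ω θs - δ * n < LFull f Y n ω θ}) atTop (𝓝 0) := by
  have hY := hstat.1
  have hprob := isProbabilityMeasure_law hstat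
  have herg := ergodic_shift hstat
  obtain ⟨c, hc, hlow⟩ := hA0.2
  obtain ⟨G, hG, hdom⟩ := exists_lintegral_bound hY hmom hΘ hA2 hLip hc hlow 0
  set F : Param d → (ℤ → ℕ) → ℝ := fun θ x => ell f coord 0 x θ with hF
  have hFm : ∀ θ ∈ Θ, Measurable (F θ) := fun θ hθ =>
    measurable_ell measurable_coord 0 (hA2.2.2.1 θ (hA2.2.1 hθ))
  have hFc : ∀ x, ContinuousOn (fun θ => F θ x) Θ := fun x => by
    have h1 : ContinuousOn (fun θ => f θ (past coord 0 x)) Θ :=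
      ((hA2.2.2.2 _).continuousOn).mono hA2.2.1
    exact (continuousOn_const.mul (h1.log fun θ hθ => (hc.trans_le (hlow θ hθ _)).ne')).sub h1
  have hp0 := measurePreserving_path hstat 0
  have hFpath : ∀ θ ω, F θ (path Y 0 ω) = ell f Y 0 ω θ := fun θ ω => by
    simp only [hF, ell_coord_path]
  have hFdom : ∫⁻ x, ⨆ θ ∈ Θ, ‖F θ x‖ₑ ∂(law μ Y) < ∞ := by
    rw [← hp0.lintegral_comp (measurable_biSup_enorm hFm hFc)]
    refine (lintegral_mono fun ω => iSup₂_le fun θ hθ => ?_).trans_lt hG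
    have := hFpath θ ω
    simp only [Nat.cast_zero] at *
    rw [this]
    exact (hdom θ hθ ω).2.2
  have hmean : ∀ θ ∈ Θ, ∫ x, F θ x ∂(law μ Y) = ∫ ω, ell f Y 0 ω θ ∂μ := fun θ hθ => by
    rw [law, integral_map (measurable_path hY 0).aemeasurable (hFm θ hθ).aestronglyMeasurable]
    simp only [hFpath]
  set K : Set (Param d) := Θ ∩ {θ | r ≤ dist θ θs} with hK
  have hKc : IsCompact K := hΘ.inter_right (isClosed_le continuous_const (by fun_prop))
  have hmain : ∃ δ : ℝ, 0 < δ ∧ Tendsto (fun n : ℕ => law μ Y {x | ∃ θ ∈ K,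
      birkhoffAverage ℝ shift (F θs) n x - δ < birkhoffAverage ℝ shift (F θ) n x})
      atTop (𝓝 0) := by
    -- The property passes to subsets and to finite unions, so by compactness it is enough to find a
    -- suitable neighbourhood of each point of `K`.
    refine hKc.induction_on (p := fun S => ∃ δ : ℝ, 0 < δ ∧ Tendsto (fun n : ℕ =>
      law μ Y {x | ∃ θ ∈ S, birkhoffAverage ℝ shift (F θs) n x - δ
        < birkhoffAverage ℝ shift (F θ) n x}) atTop (𝓝 0)) ?_ ?_ ?_ ?_
    · exact ⟨1, one_pos, by simp⟩
    · rintro S S' hSS ⟨δ, hδ, h⟩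
      refine ⟨δ, hδ, tendsto_of_tendsto_of_tendsto_of_le_of_le tendsto_const_nhds h
        (fun n => zero_le) fun n => measure_mono ?_⟩
      rintro x ⟨θ, hθ, h⟩
      exact ⟨θ, hSS hθ, h⟩
    · rintro S S' ⟨δ, hδ, h⟩ ⟨δ', hδ', h'⟩
      have hadd := h.add h'
      rw [add_zero] at hadd
      refine ⟨min δ δ', lt_min hδ hδ', tendsto_of_tendsto_of_tendsto_of_le_of_le
        tendsto_const_nhds hadd (fun n => zero_le) fun n =>
        (measure_mono ?_).trans (measure_union_le _ _)⟩
      rintro x ⟨θ, hθ | hθ, h⟩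
      · exact Or.inl ⟨θ, hθ, by linarith [min_le_left δ δ']⟩
      · exact Or.inr ⟨θ, hθ, by linarith [min_le_right δ δ']⟩
    · intro θ₀ hθ₀
      have hne : θ₀ ≠ θs := by
        rintro rfl
        have : θ₀ ∈ {θ | r ≤ dist θ θ₀} := hθ₀.2
        rw [Set.mem_ofPred_eq, dist_self] at this
        linarith
      have hgap := integral_ell_lt hY hOD hmom hΘ hA0 hA2 hLip hθs hθ₀.1 hne 0
      rw [← hmean θs hθs, ← hmean θ₀ hθ₀.1] at hgap
      -- With each average within `g / 3` of its limit, at least `g / 3` of the gap `g` survives.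
      set g := ∫ x, F θs x ∂(law μ Y) - ∫ x, F θ₀ x ∂(law μ Y) with hg
      have hg0 : 0 < g := sub_pos.2 hgap
      obtain ⟨ρ, hρ, h1⟩ := exists_tendsto_measure_birkhoffAverage herg hFm hFc hFdom hθ₀.1
        (ε := g / 3) (by linarith)
      have h2 := tendsto_measure_birkhoffAverage herg (integrable_of_dominated hFm hFdom hθs)
        (ε := g / 3) (by linarith)
      have h12 := h1.add h2
      rw [add_zero] at h12
      refine ⟨K ∩ Metric.ball θ₀ ρ, inter_mem_nhdsWithin _ (Metric.ball_mem_nhds θ₀ hρ), g / 3,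
        by linarith, tendsto_of_tendsto_of_tendsto_of_le_of_le
        tendsto_const_nhds h12 (fun n => zero_le) fun n =>
        (measure_mono ?_).trans (measure_union_le _ _)⟩
      rintro x ⟨θ, hθ, h⟩
      by_contra hcon
      obtain ⟨c1, c2⟩ := not_or.1 hcon
      have c2' : |birkhoffAverage ℝ shift (F θs) n x - ∫ y, F θs y ∂(law μ Y)| < g / 3 :=
        not_le.1 c2
      have c1' : |birkhoffAverage ℝ shift (F θ) n x - ∫ y, F θ₀ y ∂(law μ Y)| < g / 3 :=
        not_le.1 fun h => c1 ⟨θ, hθ.1.1, hθ.2, h⟩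
      have := (abs_lt.1 c1').2
      have := (abs_lt.1 c2').1
      linarith
  obtain ⟨δ, hδ, h⟩ := hmain
  refine ⟨δ, hδ, tendsto_measure_of_path hstat 1 h ?_⟩
  filter_upwards [eventually_gt_atTop 0] with n hn
  rintro ω ⟨θ, hθ, hd, hlt⟩
  refine ⟨θ, ⟨hθ, hd⟩, ?_⟩
  rw [LFull_eq_birkhoffSum, LFull_eq_birkhoffSum] at hlt
  have hn' : (0 : ℝ) < n := by exact_mod_cast hn
  simp only [birkhoffAverage, smul_eq_mul, Nat.cast_one]
  rw [sub_lt_iff_lt_add] at hlt ⊢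
  calc (n : ℝ)⁻¹ * birkhoffSum shift (F θs) n (path Y 1 ω)
      < (n : ℝ)⁻¹ * (birkhoffSum shift (F θ) n (path Y 1 ω) + δ * n) := by gcongr
    _ = _ := by field_simp

end Consistency

/-! ### Sums of orthogonal variables -/

section Orthogonal

variable {Ω : Type*} [MeasurableSpace Ω] {μ : Measure Ω}

/-- Pythagoras: the cross terms vanish, so the second moment of the sum grows linearly. -/
theorem integrable_sum_sq_and_integral_eq {D : ℕ → Ω → ℝ} {v : ℝ} (hD : ∀ k, MemLp (D k) 2 μ)
    (horth : ∀ k l, k < l → ∫ ω, D k ω * D l ω ∂μ = 0) (hv : ∀ l, ∫ ω, D l ω ^ 2 ∂μ = v) (n : ℕ) :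
    Integrable (fun ω => (∑ l ∈ Finset.range n, D l ω) ^ 2) μ ∧
      ∫ ω, (∑ l ∈ Finset.range n, D l ω) ^ 2 ∂μ = n * v := by
  have hprod : ∀ k l, Integrable (fun ω => D k ω * D l ω) μ := fun k l =>
    (hD k).integrable_mul (hD l)
  refine ⟨(memLp_finsetSum _ fun k _ => hD k).integrable_sq, ?_⟩
  induction n with
  | zero => simp
  | succ n ih =>
    have h1 : Integrable (fun ω => (∑ l ∈ Finset.range n, D l ω) ^ 2) μ :=
      (memLp_finsetSum _ fun k _ => hD k).integrable_sq
    have h2 : Integrable (fun ω => ∑ l ∈ Finset.range n, D l ω * D n ω) μ :=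
      integrable_finsetSum _ fun k _ => hprod k n
    have h3 : Integrable (fun ω => D n ω ^ 2) μ := (hD n).integrable_sq
    have e : ∀ ω, (∑ l ∈ Finset.range (n + 1), D l ω) ^ 2
        = (∑ l ∈ Finset.range n, D l ω) ^ 2 + 2 * (∑ l ∈ Finset.range n, D l ω * D n ω)
          + D n ω ^ 2 := fun ω => by
      rw [Finset.sum_range_succ, ← Finset.sum_mul]; ring
    simp_rw [e]
    rw [integral_add (by exact h1.add (h2.const_mul 2)) h3, integral_add h1 (h2.const_mul 2),
      integral_const_mul, integral_finsetSum _ fun k _ => hprod k n, ih, hv,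
      Finset.sum_eq_zero fun k hk => horth k n (Finset.mem_range.1 hk)]
    push_cast; ring

end Orthogonal

/-! ### The score as a martingale difference -/

section Score

variable {Ω : Type*} [MeasurableSpace Ω] {μ : Measure Ω} [IsProbabilityMeasure μ] {d : ℕ}
  {f : Param d → (ℕ → ℕ) → ℝ} {Y : ℤ → Ω → ℕ} {U Θ : Set (Param d)} {θs : Param d}
  {p : ℝ → PMF ℕ}

theorem measurable_pderiv_family (hA2 : SmoothFamily f U Θ) (i : Fin d) {θ : Param d}
    (hθ : θ ∈ U) : Measurable fun y => pderiv (fun η => f η y) i θ :=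
  measurable_pderiv hA2.1 hA2.2.2.1
    (fun y => (hA2.2.2.2 y).differentiableOn (by norm_num)) i hθ

theorem measurable_pderiv2_family (hA2 : SmoothFamily f U Θ) (i j : Fin d) {θ : Param d}
    (hθ : θ ∈ U) : Measurable fun y => pderiv2 (fun η => f η y) i j θ :=
  measurable_pderiv (F := fun θ y => pderiv (fun η => f η y) j θ) hA2.1
    (fun _ hη => measurable_pderiv_family hA2 j hη)
    (fun y => (contDiffOn_pderiv (m := 1) hA2.1 (hA2.2.2.2 y) (by norm_num) j).differentiableOn
      (by norm_num)) i hθ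

omit [IsProbabilityMeasure μ] in
theorem integrable_lam (hOD : IsOD μ p (f θs) Y) (t : ℤ) :
    Integrable (fun ω => lam f Y t ω θs) μ :=
  integrable_condExp.congr (hOD t).2

theorem condExp_count_sub_lam (hY : ∀ t, Measurable (Y t)) (hOD : IsOD μ p (f θs) Y)
    (hmom : MomentCondition μ Y) (hf : Measurable (f θs)) (t : ℤ) :
    μ[fun ω => (Y t ω : ℝ) - lam f Y t ω θs|pastSigma Y t] =ᵐ[μ] 0 := by
  have h1 : μ[fun ω => lam f Y t ω θs|pastSigma Y t] = fun ω => lam f Y t ω θs :=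
    condExp_of_stronglyMeasurable (pastSigma_le hY t)
      (hf.comp (measurable_past_pastSigma le_rfl)).stronglyMeasurable (integrable_lam hOD t)
  refine (condExp_sub ((memLp_two_count hY hmom t).integrable (by norm_num))
    (integrable_lam hOD t) (pastSigma Y t)).trans ?_
  rw [h1]
  filter_upwards [(hOD t).2] with ω hω
  simp only [Pi.sub_apply, hω, Pi.zero_apply, lam, sub_self]

/-- The residual has conditional mean zero, so it is orthogonal to every weight determined by the
past, as soon as the product is integrable. -/
theorem integral_count_sub_lam_mul (hY : ∀ t, Measurable (Y t)) (hOD : IsOD μ p (f θs) Y)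
    (hmom : MomentCondition μ Y) (hf : Measurable (f θs)) (t : ℤ) {W : Ω → ℝ}
    (hW : Measurable[pastSigma Y t] W)
    (hi : Integrable (fun ω => ((Y t ω : ℝ) - lam f Y t ω θs) * W ω) μ) :
    ∫ ω, ((Y t ω : ℝ) - lam f Y t ω θs) * W ω ∂μ = 0 := by
  refine (integral_mul_eq_integral_condExp_mul (pastSigma_le hY t)
    (((memLp_two_count hY hmom t).integrable (by norm_num)).sub (integrable_lam hOD t)) hW hi).trans
    ((integral_congr_ae (g := fun _ => 0) ?_).trans (by simp))
  filter_upwards [condExp_count_sub_lam hY hOD hmom hf t] with ω hω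
  exact mul_eq_zero_of_left hω _

omit [MeasurableSpace Ω] in
-- The factorization exhibits the score as a residual times a function of the past.
theorem pderiv_ell (hA2 : SmoothFamily f U Θ) {θ : Param d} (hθ : θ ∈ U)
    (hpos : ∀ y, 0 < f θ y) (i : Fin d) (t : ℤ) (ω : Ω) :
    pderiv (ell f Y t ω) i θ = ((Y t ω : ℝ) - lam f Y t ω θ) *
      ((f θ (past Y t ω))⁻¹ * pderiv (fun η => f η (past Y t ω)) i θ) := by
  rw [ell_eq_quasiLog, pderiv_quasiLog _ (((hA2.2.2.2 _).differentiableOn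
    (by norm_num)).differentiableAt (hA2.1.mem_nhds hθ)) (hpos _)]
  have := (hpos (past Y t ω)).ne'
  simp only [lam]
  field_simp

/-- Conditionally on the past, the squared residual becomes the conditional variance, and finiteness
of the diagonal of `I(θ*)` gives the second moment. -/
theorem memLp_score (hY : ∀ t, Measurable (Y t)) (hOD : IsOD μ p (f θs) Y)
    (hmom : MomentCondition μ Y) (hA2 : SmoothFamily f U Θ) (hθs : θs ∈ U)
    (hpos : ∀ y, 0 < f θs y) (hA4 : FiniteInformation μ f Y θs) (i : Fin d) (t : ℤ) :
    MemLp (fun ω => pderiv (ell f Y t ω) i θs) 2 μ := by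
  have hf := hA2.2.2.1 θs hθs
  have hYm : Measurable fun ω => (Y t ω : ℝ) := measurable_from_top.comp (hY t)
  have hgm : Measurable fun y => (f θs y)⁻¹ * pderiv (fun η => f η y) i θs :=
    hf.inv.mul (measurable_pderiv_family hA2 i hθs)
  have hlm : Measurable fun ω => lam f Y t ω θs := hf.comp (measurable_past hY t)
  have hce : μ[fun ω => (Y t ω : ℝ)|pastSigma Y t] =ᵐ[μ] fun ω => lam f Y t ω θs := (hOD t).2
  have hY2 := memLp_two_count hY hmom t
  have hl2 : MemLp (fun ω => lam f Y t ω θs) 2 μ := (hY2.condExp one_le_two).ae_eq hce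
  have hX : Integrable (fun ω => ((Y t ω : ℝ) - lam f Y t ω θs) ^ 2) μ :=
    (hY2.sub hl2).integrable_sq
  have hvar : ProbabilityTheory.condVar (pastSigma Y t) (fun ω' => (Y t ω' : ℝ)) μ
      =ᵐ[μ] μ[fun ω => ((Y t ω : ℝ) - lam f Y t ω θs) ^ 2|pastSigma Y t] := by
    refine condExp_congr_ae ?_
    filter_upwards [hce] with ω hω
    simp [hω]
  have hWi : Integrable (fun ω => ((Y t ω : ℝ) - lam f Y t ω θs) ^ 2 *
      ((f θs (past Y t ω))⁻¹ * pderiv (fun η => f η (past Y t ω)) i θs) ^ 2) μ := by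
    refine integrable_mul_of_condExp_mul (pastSigma_le hY t) hX (fun ω => sq_nonneg _)
      ((hgm.comp (measurable_past_pastSigma le_rfl)).pow_const 2) ?_
    refine (hA4 t i i).2.congr ?_
    filter_upwards [hvar] with ω hω
    rw [hω]
    simp only [lam, div_eq_mul_inv]
    have := (hpos (past Y t ω)).ne'
    field_simp
    rfl
  have hpe : (fun ω => pderiv (ell f Y t ω) i θs) = fun ω => ((Y t ω : ℝ) - lam f Y t ω θs) *
      ((f θs (past Y t ω))⁻¹ * pderiv (fun η => f η (past Y t ω)) i θs) := by
    ext ω; exact pderiv_ell hA2 hθs hpos i t ω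
  rw [hpe]
  refine (memLp_two_iff_integrable_sq
    ((hYm.sub hlm).mul (hgm.comp (measurable_past hY t))).aestronglyMeasurable).2 ?_
  refine hWi.congr (ae_of_all _ fun ω => ?_)
  simp only [Function.comp_apply, Pi.mul_apply, Pi.sub_apply, mul_pow]

/-- The earlier score belongs to the past of the later one. -/
theorem integral_score_mul_score (hY : ∀ t, Measurable (Y t)) (hOD : IsOD μ p (f θs) Y)
    (hmom : MomentCondition μ Y) (hA2 : SmoothFamily f U Θ) (hθs : θs ∈ U)
    (hpos : ∀ y, 0 < f θs y) (hA4 : FiniteInformation μ f Y θs) (i : Fin d) {s t : ℤ}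
    (hst : s < t) :
    ∫ ω, pderiv (ell f Y s ω) i θs * pderiv (ell f Y t ω) i θs ∂μ = 0 := by
  have hf := hA2.2.2.1 θs hθs
  have hgm : Measurable fun y => (f θs y)⁻¹ * pderiv (fun η => f η y) i θs :=
    hf.inv.mul (measurable_pderiv_family hA2 i hθs)
  have hms := (memLp_score hY hOD hmom hA2 hθs hpos hA4 i s).integrable_mul
    (memLp_score hY hOD hmom hA2 hθs hpos hA4 i t)
  have e : ∀ ω, pderiv (ell f Y s ω) i θs * pderiv (ell f Y t ω) i θs
      = ((Y t ω : ℝ) - lam f Y t ω θs) *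
        ((((Y s ω : ℝ) - lam f Y s ω θs) *
          ((f θs (past Y s ω))⁻¹ * pderiv (fun η => f η (past Y s ω)) i θs)) *
        ((f θs (past Y t ω))⁻¹ * pderiv (fun η => f η (past Y t ω)) i θs)) := fun ω => by
    rw [pderiv_ell hA2 hθs hpos, pderiv_ell hA2 hθs hpos]; ring
  simp_rw [e]
  refine integral_count_sub_lam_mul hY hOD hmom hf t ?_ (hms.congr (ae_of_all _ e))
  have m1 : Measurable[pastSigma Y t] fun ω => (Y s ω : ℝ) :=
    measurable_from_top.comp (measurable_pastSigma hst)
  have m2 : Measurable[pastSigma Y t] fun ω => lam f Y s ω θs :=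
    hf.comp (measurable_past_pastSigma hst.le)
  exact ((m1.sub m2).mul (hgm.comp (measurable_past_pastSigma hst.le))).mul
    (hgm.comp (measurable_past_pastSigma le_rfl))

omit [IsProbabilityMeasure μ] in
theorem integral_score_sq (hstat : StationaryErgodic μ Y) (hA2 : SmoothFamily f U Θ)
    (hθs : θs ∈ U) (hpos : ∀ y, 0 < f θs y) (i : Fin d) (n : ℕ) :
    ∫ ω, pderiv (ell f Y n ω) i θs ^ 2 ∂μ
      = ∫ x, pderiv (ell f coord 0 x) i θs ^ 2 ∂(law μ Y) := by
  have hf := hA2.2.2.1 θs hθs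
  have hp := measurePreserving_path hstat n
  have hm : Measurable fun x => pderiv (ell f coord 0 x) i θs := by
    simp_rw [pderiv_ell hA2 hθs hpos]
    have hc : Measurable fun x => (coord 0 x : ℝ) := measurable_from_top.comp (measurable_coord 0)
    exact (hc.sub (hf.comp (measurable_past measurable_coord 0))).mul
      ((hf.inv.mul (measurable_pderiv_family hA2 i hθs)).comp (measurable_past measurable_coord 0))
  rw [← hp.map_eq, integral_map hp.measurable.aemeasurable (hm.pow_const 2).aestronglyMeasurable]
  simp only [ell_coord_path]

/-- The score at the true parameter is of order `√n`. -/
theorem exists_lintegral_score_le (hstat : StationaryErgodic μ Y) (hOD : IsOD μ p (f θs) Y)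
    (hmom : MomentCondition μ Y) (hA2 : SmoothFamily f U Θ) (hθs : θs ∈ U)
    (hpos : ∀ y, 0 < f θs y) (hA4 : FiniteInformation μ f Y θs) :
    ∃ v : ℝ, 0 ≤ v ∧ ∀ n : ℕ,
      Integrable (fun ω => ∑ i, (∑ l ∈ Finset.range n,
        pderiv (ell f Y (l + 1 : ℕ) ω) i θs) ^ 2) μ ∧
      ∫ ω, ∑ i, (∑ l ∈ Finset.range n, pderiv (ell f Y (l + 1 : ℕ) ω) i θs) ^ 2 ∂μ = n * v := by
  have h := fun i => integrable_sum_sq_and_integral_eq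
    (D := fun l ω => pderiv (ell f Y (l + 1 : ℕ) ω) i θs)
    (fun k => memLp_score hstat.1 hOD hmom hA2 hθs hpos hA4 i _)
    (fun k l hkl => integral_score_mul_score hstat.1 hOD hmom hA2 hθs hpos hA4 i
      (by exact_mod_cast Nat.succ_lt_succ hkl))
    (fun l => integral_score_sq hstat hA2 hθs hpos i (l + 1))
  refine ⟨∑ i, ∫ x, pderiv (ell f coord 0 x) i θs ^ 2 ∂(law μ Y),
    Finset.sum_nonneg fun i _ => integral_nonneg fun x => sq_nonneg _, fun n =>
    ⟨integrable_finsetSum _ fun i _ => (h i n).1, ?_⟩⟩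
  rw [integral_finsetSum _ fun i _ => (h i n).1, Finset.mul_sum]
  exact Finset.sum_congr rfl fun i _ => (h i n).2

end Score

/-! ### The Hessian and the information matrix -/

section Hessian

variable {Ω : Type*} [MeasurableSpace Ω] {μ : Measure Ω} [IsProbabilityMeasure μ] {d : ℕ}
  {f : Param d → (ℕ → ℕ) → ℝ} {Y : ℤ → Ω → ℕ} {U Θ : Set (Param d)} {θs : Param d}
  {p : ℝ → PMF ℕ}

omit [MeasurableSpace Ω] in
-- The second derivatives of the mean are collected in front of the residual: at `θ*` that term has
-- expectation zero, and the other one produces `-J(θ*)`.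
theorem pderiv2_ell (hA2 : SmoothFamily f U Θ) {θ : Param d} (hθ : θ ∈ U)
    (hpos : ∀ y, 0 < f θ y) (i j : Fin d) (t : ℤ) (ω : Ω) :
    pderiv2 (ell f Y t ω) i j θ = ((Y t ω : ℝ) - lam f Y t ω θ) *
      ((f θ (past Y t ω))⁻¹ * pderiv2 (fun η => f η (past Y t ω)) i j θ)
      - (Y t ω : ℝ) * ((f θ (past Y t ω) ^ 2)⁻¹ *
        (pderiv (fun η => f η (past Y t ω)) i θ * pderiv (fun η => f η (past Y t ω)) j θ)) := by
  rw [ell_eq_quasiLog, pderiv2_quasiLog _ hA2.1 (hA2.2.2.2 _) hθ (hpos _)]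
  have := (hpos (past Y t ω)).ne'
  simp only [lam]
  field_simp

theorem measurable_pderiv2_ell (hY : ∀ t, Measurable (Y t)) (hA2 : SmoothFamily f U Θ)
    {θ : Param d} (hθ : θ ∈ U) (hpos : ∀ y, 0 < f θ y) (i j : Fin d) (t : ℤ) :
    Measurable fun ω => pderiv2 (ell f Y t ω) i j θ := by
  simp_rw [pderiv2_ell hA2 hθ hpos]
  have hf := hA2.2.2.1 θ hθ
  have hYm : Measurable fun ω => (Y t ω : ℝ) := measurable_from_top.comp (hY t)
  have hp := measurable_past hY t
  exact ((hYm.sub (hf.comp hp)).mul ((hf.inv.mul (measurable_pderiv2_family hA2 i j hθ)).comp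
    hp)).sub (hYm.mul (((hf.pow_const 2).inv.mul ((measurable_pderiv_family hA2 i hθ).mul
      (measurable_pderiv_family hA2 j hθ))).comp hp))

/-- The expected Hessian of the quasi-log-likelihood at the true parameter is `-J(θ*)`. -/
theorem integral_pderiv2_ell (hY : ∀ t, Measurable (Y t)) (hOD : IsOD μ p (f θs) Y)
    (hmom : MomentCondition μ Y) (hA2 : SmoothFamily f U Θ) (hθs : θs ∈ U)
    (hpos : ∀ y, 0 < f θs y) (hA4 : FiniteInformation μ f Y θs) (i j : Fin d) (t : ℤ)
    (hi : Integrable (fun ω => pderiv2 (ell f Y t ω) i j θs) μ) :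
    ∫ ω, pderiv2 (ell f Y t ω) i j θs ∂μ
      = -∫ ω, (lam f Y t ω θs)⁻¹ *
          (pderiv (lam f Y t ω) i θs * pderiv (lam f Y t ω) j θs) ∂μ := by
  have hf := hA2.2.2.1 θs hθs
  have hYi : Integrable (fun ω => (Y t ω : ℝ)) μ :=
    (memLp_two_count hY hmom t).integrable (by norm_num)
  have hce : μ[fun ω => (Y t ω : ℝ)|pastSigma Y t] =ᵐ[μ] fun ω => lam f Y t ω θs := (hOD t).2
  have hgm : Measurable fun y => (f θs y ^ 2)⁻¹ *
      (pderiv (fun η => f η y) i θs * pderiv (fun η => f η y) j θs) :=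
    (hf.pow_const 2).inv.mul ((measurable_pderiv_family hA2 i hθs).mul
      (measurable_pderiv_family hA2 j hθs))
  have hhm : Measurable fun y => (f θs y)⁻¹ * pderiv2 (fun η => f η y) i j θs :=
    hf.inv.mul (measurable_pderiv2_family hA2 i j hθs)
  have hJ : (fun ω => (μ[fun ω => (Y t ω : ℝ)|pastSigma Y t]) ω * ((f θs (past Y t ω) ^ 2)⁻¹ *
      (pderiv (fun η => f η (past Y t ω)) i θs * pderiv (fun η => f η (past Y t ω)) j θs)))
      =ᵐ[μ] fun ω => (lam f Y t ω θs)⁻¹ *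
          (pderiv (lam f Y t ω) i θs * pderiv (lam f Y t ω) j θs) := by
    filter_upwards [hce] with ω hω
    rw [hω]
    have := (hpos (past Y t ω)).ne'
    simp only [lam]
    field_simp
    rfl
  have hgm' := hgm.comp (measurable_past_pastSigma (Y := Y) (le_refl t))
  have hYg : Integrable (fun ω => (Y t ω : ℝ) * ((f θs (past Y t ω) ^ 2)⁻¹ *
      (pderiv (fun η => f η (past Y t ω)) i θs * pderiv (fun η => f η (past Y t ω)) j θs))) μ :=
    integrable_mul_of_condExp_mul (pastSigma_le hY t) hYi (fun ω => Nat.cast_nonneg _) hgm'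
      ((hA4 t i j).1.congr hJ.symm)
  -- The residual term is the Hessian plus a term controlled by `J(θ*)`, so its integrability needs
  -- no separate bound on the second derivatives of the mean.
  have hZ : Integrable (fun ω => ((Y t ω : ℝ) - lam f Y t ω θs) *
      ((f θs (past Y t ω))⁻¹ * pderiv2 (fun η => f η (past Y t ω)) i j θs)) μ := by
    refine (hi.add hYg).congr (ae_of_all _ fun ω => ?_)
    simp only [Pi.add_apply]
    rw [pderiv2_ell hA2 hθs hpos]; ring
  simp_rw [pderiv2_ell hA2 hθs hpos]
  have hZ0 := integral_count_sub_lam_mul hY hOD hmom hf t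
    (W := fun ω => (f θs (past Y t ω))⁻¹ * pderiv2 (fun η => f η (past Y t ω)) i j θs)
    (hhm.comp (measurable_past_pastSigma le_rfl)) hZ
  rw [integral_sub hZ hYg, hZ0, zero_sub]
  congr 1
  refine (integral_mul_eq_integral_condExp_mul (pastSigma_le hY t) hYi hgm' hYg).trans
    (integral_congr_ae hJ)

/-- A positive continuous function has a positive minimum on the compact unit sphere; homogeneity of
degree two extends the bound to all vectors. -/
theorem exists_pos_le_of_sphere {Q : Param d → ℝ} (hQc : Continuous Q)
    (hQh : ∀ (a : ℝ) h, Q (a • h) = a ^ 2 * Q h) (hQ : ∀ h, h ≠ 0 → 0 < Q h) :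
    ∃ c : ℝ, 0 < c ∧ ∀ h, c * ‖h‖ ^ 2 ≤ Q h := by
  have hcomp : IsCompact (Metric.sphere (0 : Param d) 1) := isCompact_sphere 0 1
  obtain ⟨c, hc, hcs⟩ : ∃ c : ℝ, 0 < c ∧ ∀ h ∈ Metric.sphere (0 : Param d) 1, c ≤ Q h := by
    rcases (Metric.sphere (0 : Param d) 1).eq_empty_or_nonempty with he | hne
    · exact ⟨1, one_pos, fun h hh => by simp [he] at hh⟩
    · obtain ⟨h0, hh0, hmin⟩ := hcomp.exists_isMinOn hne hQc.continuousOn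
      refine ⟨Q h0, hQ h0 ?_, fun h hh => hmin hh⟩
      rintro rfl
      simp at hh0
  refine ⟨c, hc, fun h => ?_⟩
  rcases eq_or_ne h 0 with rfl | hne
  · have := hQh 0 0
    simp at this
    simp [this]
  · have hn : ‖h‖ ≠ 0 := norm_ne_zero_iff.2 hne
    have h1 := hcs (‖h‖⁻¹ • h) (by simp [norm_smul, hn])
    rw [hQh] at h1
    have h2 : 0 < ‖h‖ ^ 2 := by positivity
    calc c * ‖h‖ ^ 2 ≤ (‖h‖⁻¹ ^ 2 * Q h) * ‖h‖ ^ 2 := by gcongr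
      _ = Q h := by field_simp

omit [IsProbabilityMeasure μ] in
/-- `J(θ*)` is positive definite. -/
theorem exists_pos_le_information (hpos : ∀ y, 0 < f θs y) (hA4 : FiniteInformation μ f Y θs)
    (hA5 : NondegenerateGradient μ f Y θs) (t : ℤ) :
    ∃ c : ℝ, 0 < c ∧ ∀ h : Param d, c * ‖h‖ ^ 2 ≤ ∑ j, h j * ∑ i, h i *
      ∫ ω, (lam f Y t ω θs)⁻¹ *
          (pderiv (lam f Y t ω) i θs * pderiv (lam f Y t ω) j θs) ∂μ := by
  refine exists_pos_le_of_sphere (by fun_prop) (fun a h => ?_) fun h hh => ?_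
  · simp only [PiLp.smul_apply, smul_eq_mul, Finset.mul_sum]
    refine Finset.sum_congr rfl fun j _ => Finset.sum_congr rfl fun i _ => by ring
  · have hint : ∀ i j, Integrable (fun ω => h j * (h i * ((lam f Y t ω θs)⁻¹ *
        (pderiv (lam f Y t ω) i θs * pderiv (lam f Y t ω) j θs)))) μ := fun i j =>
      ((hA4 t i j).1.const_mul _).const_mul _
    have e1 : ∀ ω, (lam f Y t ω θs)⁻¹ * (∑ i, h i * pderiv (lam f Y t ω) i θs) ^ 2
        = ∑ j, ∑ i, h j * (h i * ((lam f Y t ω θs)⁻¹ *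
          (pderiv (lam f Y t ω) i θs * pderiv (lam f Y t ω) j θs))) := fun ω => by
      rw [sq, Finset.sum_mul_sum, Finset.mul_sum, Finset.sum_comm]
      simp_rw [Finset.mul_sum]
      refine Finset.sum_congr rfl fun j _ => Finset.sum_congr rfl fun i _ => by ring
    have e : ∑ j, h j * ∑ i, h i * ∫ ω, (lam f Y t ω θs)⁻¹ *
          (pderiv (lam f Y t ω) i θs * pderiv (lam f Y t ω) j θs) ∂μ
        = ∫ ω, (lam f Y t ω θs)⁻¹ * (∑ i, h i * pderiv (lam f Y t ω) i θs) ^ 2 ∂μ := by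
      simp_rw [e1]
      rw [integral_finsetSum _ fun j _ => integrable_finsetSum _ fun i _ => hint i j]
      refine Finset.sum_congr rfl fun j _ => ?_
      rw [integral_finsetSum _ fun i _ => hint i j, Finset.mul_sum]
      refine Finset.sum_congr rfl fun i _ => ?_
      rw [integral_const_mul, integral_const_mul]
    rw [e]
    have hnn : ∀ ω, 0 ≤ (lam f Y t ω θs)⁻¹ * (∑ i, h i * pderiv (lam f Y t ω) i θs) ^ 2 :=
      fun ω => mul_nonneg (inv_nonneg.2 (hpos _).le) (sq_nonneg _)
    -- If the integral of the nonnegative function vanished, `h' ∂λ_t(θ*)` would be zero almost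
    -- surely, against nondegeneracy of the gradient.
    refine lt_of_le_of_ne (integral_nonneg hnn) fun h0 => hh (hA5 t h ?_)
    have hi : Integrable (fun ω => (lam f Y t ω θs)⁻¹ *
        (∑ i, h i * pderiv (lam f Y t ω) i θs) ^ 2) μ := by
      simp_rw [e1]
      exact integrable_finsetSum _ fun j _ => integrable_finsetSum _ fun i _ => hint i j
    filter_upwards [(integral_eq_zero_iff_of_nonneg hnn hi).1 h0.symm] with ω hω
    rcases mul_eq_zero.1 hω with h1 | h1
    · exact absurd h1 (inv_ne_zero (hpos _).ne')
    · exact pow_eq_zero_iff two_ne_zero |>.1 h1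

end Hessian

/-! ### The gain near the true parameter -/

section Local

variable {Ω : Type*} [MeasurableSpace Ω] {μ : Measure Ω} [IsProbabilityMeasure μ] {d : ℕ}
  {f : Param d → (ℕ → ℕ) → ℝ} {Y : ℤ → Ω → ℕ} {U Θ : Set (Param d)} {θs : Param d}
  {p : ℝ → PMF ℕ}

/-- The maximum of a linear minus a quadratic term: `√(N A) - b N ≤ A / (4 b)`, by completing the
square. -/
theorem le_of_sq_le_mul {x N A b : ℝ} (hb : 0 < b) (hN : 0 ≤ N) (hA : 0 ≤ A)
    (h : x ^ 2 ≤ N * A) : x - b * N ≤ A / (4 * b) := by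
  by_contra hcon
  have h1 : b * N + A / (4 * b) < x := by linarith
  have h2 : 0 ≤ b * N + A / (4 * b) := by positivity
  have h3 : (b * N + A / (4 * b)) ^ 2 < x ^ 2 := by gcongr
  have h4 : N * A ≤ (b * N + A / (4 * b)) ^ 2 := by
    have h5 : (b * N + A / (4 * b)) ^ 2 = (b * N - A / (4 * b)) ^ 2 + N * A := by
      field_simp; ring
    rw [h5]
    linarith [sq_nonneg (b * N - A / (4 * b))]
  linarith

theorem sum_sum_le_of_abs_le {h : Param d} {e : Fin d → Fin d → ℝ} {η : ℝ}
    (he : ∀ i j, |e i j| ≤ η) :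
    ∑ j, h j * ∑ i, h i * e i j ≤ (d : ℝ) ^ 2 * η * ‖h‖ ^ 2 := by
  have hle : ∀ i, |h i| ≤ ‖h‖ := fun i => PiLp.norm_apply_le h i
  calc ∑ j, h j * ∑ i, h i * e i j = ∑ j, ∑ i, h j * (h i * e i j) := by
        simp_rw [Finset.mul_sum]
    _ ≤ ∑ _j : Fin d, ∑ _i : Fin d, ‖h‖ * (‖h‖ * η) := by
        refine Finset.sum_le_sum fun j _ => Finset.sum_le_sum fun i _ => ?_
        refine (le_abs_self _).trans ?_
        rw [abs_mul, abs_mul]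
        gcongr
        · exact hle j
        · exact hle i
        · exact he i j
    _ = _ := by simp; ring

theorem exists_pos_forall_le {ι : Type*} [Finite ι] {ρ : ι → ℝ} (hρ : ∀ i, 0 < ρ i) :
    ∃ r : ℝ, 0 < r ∧ ∀ i, r ≤ ρ i := by
  have h : ∀ᶠ r in 𝓝[>] (0 : ℝ), ∀ i, r ≤ ρ i := eventually_all.2 fun i =>
    (eventually_le_nhds (hρ i)).filter_mono nhdsWithin_le_nhds
  obtain ⟨r, hr, hr0⟩ := (h.and self_mem_nhdsWithin).exists
  exact ⟨r, hr0, hr⟩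

/-- Near the true parameter the quasi-log-likelihood exceeds its value at the true parameter by a
stochastically bounded amount at most. -/
theorem exists_tendsto_measure_LFull_near (hstat : StationaryErgodic μ Y)
    (hOD : IsOD μ p (f θs) Y) (hmom : MomentCondition μ Y) (hA2 : SmoothFamily f U Θ)
    (hθs : θs ∈ Θ) (hA4 : FiniteInformation μ f Y θs) (hA5 : NondegenerateGradient μ f Y θs)
    (hA6 : DominatedHessian μ f Y U Θ θs) {κ : ℕ → ℝ} (hκ : Tendsto κ atTop atTop) :
    ∃ r : ℝ, 0 < r ∧ ∀ ε : ℝ, 0 < ε → Tendsto (fun n : ℕ => μ {ω | ∃ θ ∈ Θ, dist θ θs < r ∧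
      ε * κ n ≤ LFull f Y n ω θ - LFull f Y n ω θs}) atTop (𝓝 0) := by
  have hY := hstat.1
  have hprob := isProbabilityMeasure_law hstat
  obtain ⟨V, hVn, hstar, hVU, hVpos, hVdom⟩ := hA6
  have hθV : θs ∈ V := mem_of_mem_nhdsWithin hθs hVn
  have hpos := hVpos θs hθV
  have hθU := hVU hθV
  obtain ⟨r1, hr1, hr1V⟩ := Metric.mem_nhdsWithin_iff.1 hVn
  set F : Fin d × Fin d → Param d → (ℤ → ℕ) → ℝ :=
    fun q θ x => pderiv2 (ell f coord 0 x) q.1 q.2 θ with hF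
  have hFm : ∀ q, ∀ θ ∈ V, Measurable (F q θ) := fun q θ hθ =>
    measurable_pderiv2_ell measurable_coord hA2 (hVU hθ) (hVpos θ hθ) q.1 q.2 0
  have hFc : ∀ q, ∀ x, ContinuousOn (fun θ => F q θ x) V := fun q x => by
    have hW := isOpen_pos hA2.1 (hA2.2.2.2 (past coord 0 x))
    have h1 : ContDiffOn ℝ 2 (ell f coord 0 x) {θ | θ ∈ U ∧ 0 < f θ (past coord 0 x)} :=
      contDiffOn_quasiLog _ (hA2.2.2.2 _)
    have h2 := contDiffOn_pderiv (m := 0) hW (contDiffOn_pderiv (m := 1) hW h1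
      (by norm_num) q.2) (by norm_num) q.1
    exact h2.continuousOn.mono fun θ hθ => ⟨hVU hθ, hVpos θ hθ _⟩
  have hp0 := measurePreserving_path hstat 0
  have hFpath : ∀ q θ (s : ℕ) ω, F q θ (path Y s ω) = pderiv2 (ell f Y s ω) q.1 q.2 θ :=
    fun q θ s ω => by simp only [hF, ell_coord_path]
  have hFdom : ∀ q, ∫⁻ x, ⨆ θ ∈ V, ‖F q θ x‖ₑ ∂(law μ Y) < ∞ := fun q => by
    rw [← hp0.lintegral_comp (measurable_biSup_enorm (hFm q) (hFc q))]
    simp only [hFpath]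
    exact hVdom _ q.1 q.2
  have hmean : ∀ q, ∫ x, F q θs x ∂(law μ Y) = -∫ ω, (lam f Y (0 : ℕ) ω θs)⁻¹ *
      (pderiv (lam f Y (0 : ℕ) ω) q.1 θs * pderiv (lam f Y (0 : ℕ) ω) q.2 θs) ∂μ := fun q => by
    have hi : Integrable (F q θs) (law μ Y) := integrable_of_dominated (hFm q) (hFdom q) hθV
    have hi' := hp0.integrable_comp_of_integrable hi
    rw [← hp0.map_eq, integral_map hp0.measurable.aemeasurable
      (hFm q θs hθV).aestronglyMeasurable]
    simp only [Function.comp_def, hFpath] at hi' ⊢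
    exact integral_pderiv2_ell hY hOD hmom hA2 hθU hpos hA4 q.1 q.2 _ hi'
  obtain ⟨c, hc, hJ⟩ := exists_pos_le_information hpos hA4 hA5 (0 : ℕ)
  -- Entrywise errors below `η` change the quadratic form by at most `d² η ‖h‖² ≤ (c / 2) ‖h‖²`,
  -- leaving half of the curvature `c`. The `+ 1` covers `d = 0`.
  set η : ℝ := c / (2 * ((d : ℝ) ^ 2 + 1)) with hη
  have hη0 : 0 < η := by positivity
  choose ρ hρ hρt using fun q => exists_tendsto_measure_birkhoffAverage (ergodic_shift hstat)
    (hFm q) (hFc q) (hFdom q) hθV hη0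
  obtain ⟨ρ0, hρ0, hρle⟩ := exists_pos_forall_le hρ
  set A : ℕ → Set (ℤ → ℕ) := fun n => ⋃ q, {x | ∃ θ ∈ V, dist θ θs < ρ q ∧
      η ≤ |birkhoffAverage ℝ shift (F q θ) n x - ∫ y, F q θs y ∂(law μ Y)|} with hA
  have hAt : Tendsto (fun n => law μ Y (A n)) atTop (𝓝 0) := by
    have hsum := tendsto_finsetSum Finset.univ fun q (_ : q ∈ Finset.univ) => hρt q
    rw [Finset.sum_const_zero] at hsum
    exact tendsto_of_tendsto_of_tendsto_of_le_of_le tendsto_const_nhds hsum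
      (fun n => zero_le) fun n => measure_iUnion_fintype_le _ _
  have hB1 : Tendsto (fun n => μ {ω | path Y 1 ω ∈ A n}) atTop (𝓝 0) :=
    tendsto_measure_of_path hstat 1 hAt (Eventually.of_forall fun n ω hω => hω)
  obtain ⟨v, hv0, hv⟩ := exists_lintegral_score_le hstat hOD hmom hA2 hθU hpos hA4
  refine ⟨min r1 ρ0, lt_min hr1 hρ0, fun ε hε => ?_⟩
  set S : ℕ → Ω → ℝ := fun n ω => ∑ i, (∑ l ∈ Finset.range n,
    pderiv (ell f Y (l + 1 : ℕ) ω) i θs) ^ 2 with hS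
  have hS0 : ∀ n ω, 0 ≤ S n ω := fun n ω => Finset.sum_nonneg fun i _ => sq_nonneg _
  -- Markov's inequality: the squared score has expectation `n v`, negligible against `n κ_n`.
  have hB2 : Tendsto (fun n : ℕ => μ {ω | n * (ε * c * κ n) ≤ S n ω}) atTop (𝓝 0) := by
    have hlim : Tendsto (fun n => ENNReal.ofReal (v / (ε * c) * (κ n)⁻¹)) atTop (𝓝 0) := by
      have := ENNReal.tendsto_ofReal ((hκ.inv_tendsto_atTop).const_mul (v / (ε * c)))
      simpa using this
    refine tendsto_of_tendsto_of_tendsto_of_le_of_le' tendsto_const_nhds hlim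
      (Eventually.of_forall fun n => zero_le) ?_
    filter_upwards [hκ.eventually_gt_atTop 0, eventually_gt_atTop 0] with n hn hn0
    have hn' : (0 : ℝ) < n := by exact_mod_cast hn0
    have hlev : 0 < n * (ε * c * κ n) := by positivity
    have hmark := mul_meas_ge_le_integral_of_nonneg (ae_of_all _ (hS0 n)) (hv n).1
      (n * (ε * c * κ n))
    rw [(hv n).2] at hmark
    rw [← ENNReal.ofReal_toReal (measure_ne_top μ {ω | n * (ε * c * κ n) ≤ S n ω})]
    refine ENNReal.ofReal_le_ofReal ?_
    have h1 : (n * (ε * c * κ n)) * μ.real {ω | n * (ε * c * κ n) ≤ S n ω} ≤ n * v := hmark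
    change μ.real _ ≤ _
    rw [mul_comm, ← le_div_iff₀ hlev] at h1
    refine h1.trans (le_of_eq ?_)
    field_simp
  have hB := hB1.add hB2
  rw [add_zero] at hB
  refine tendsto_of_tendsto_of_tendsto_of_le_of_le' tendsto_const_nhds hB
    (Eventually.of_forall fun n => zero_le) ?_
  filter_upwards [eventually_gt_atTop 0] with n hn0
  refine (measure_mono ?_).trans (measure_union_le _ _)
  rintro ω ⟨θ, hθ, hd, hle⟩
  by_contra hcon
  obtain ⟨c1, c2⟩ := not_or.1 hcon
  have c2' : S n ω < n * (ε * c * κ n) := not_le.1 c2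
  have hn' : (0 : ℝ) < n := by exact_mod_cast hn0
  set h : Param d := θ - θs with hh
  have hθe : θs + h = θ := by simp [hh]
  have hnorm : ‖h‖ = dist θ θs := by rw [hh, dist_eq_norm]
  have hθV' : θ ∈ V := hr1V ⟨hd.trans_le (min_le_left _ _), hθ⟩
  -- `Θ` need not be convex; star-shapedness of `V` keeps the segment where the Hessian is
  -- controlled.
  have hsegV : ∀ s ∈ Set.Icc (0 : ℝ) 1, θs + s • h ∈ V := fun s hs =>
    hstar.add_smul_sub_mem hθV' hs.1 hs.2
  have hsegd : ∀ s ∈ Set.Icc (0 : ℝ) 1, dist (θs + s • h) θs < ρ0 := fun s hs => by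
    rw [dist_eq_norm, add_sub_cancel_left, norm_smul, Real.norm_of_nonneg hs.1, hnorm]
    exact (mul_le_of_le_one_left dist_nonneg hs.2).trans_lt (hd.trans_le (min_le_right _ _))
  -- `V` need not be open, while differentiation takes place on open sets. `W` is an open set
  -- containing `V` on which the `n` terms are smooth.
  set W : Set (Param d) := ⋂ l ∈ Finset.range n,
    {θ | θ ∈ U ∧ 0 < f θ (past Y (l + 1 : ℕ) ω)} with hW
  have hWo : IsOpen W := isOpen_biInter_finset fun l _ => isOpen_pos hA2.1 (hA2.2.2.2 _)
  have hVW : V ⊆ W := fun θ hθ => Set.mem_iInter₂.2 fun l _ => ⟨hVU hθ, hVpos θ hθ _⟩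
  have hell : ∀ l ∈ Finset.range n, ContDiffOn ℝ 2 (ell f Y (l + 1 : ℕ) ω) W := fun l hl =>
    (contDiffOn_quasiLog _ (hA2.2.2.2 _)).mono (Set.iInter₂_subset l hl)
  have hLC : ContDiffOn ℝ 2 (LFull f Y n ω) W := ContDiffOn.sum hell
  have hp2 : ∀ i j, ∀ ξ ∈ V, pderiv2 (LFull f Y n ω) i j ξ
      = n * birkhoffAverage ℝ shift (F (i, j) ξ) n (path Y 1 ω) := fun i j ξ hξ => by
    have h1 : pderiv2 (LFull f Y n ω) i j ξ
        = ∑ l ∈ Finset.range n, pderiv2 (ell f Y (l + 1 : ℕ) ω) i j ξ :=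
      pderiv2_sum hWo hell i j (hVW hξ)
    rw [h1, birkhoffAverage, smul_eq_mul, mul_inv_cancel_left₀ hn'.ne']
    refine Finset.sum_congr rfl fun l _ => ?_
    have h2 : (1 : ℤ) + l = (l + 1 : ℕ) := by push_cast; ring
    rw [shift_iterate_path, h2, hFpath]
  have hp1 : ∀ i, pderiv (LFull f Y n ω) i θs
      = ∑ l ∈ Finset.range n, pderiv (ell f Y (l + 1 : ℕ) ω) i θs := fun i =>
    pderiv_sum (fun l hl => ((hell l hl).differentiableOn (by norm_num)).differentiableAt
      (hWo.mem_nhds (hVW hθV))) i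
  have htaylor := sub_le_of_pderiv2_le hWo hLC (h := h) (fun s hs => hVW (hsegV s hs))
    (K := n * (c / 2) * ‖h‖ ^ 2) fun s hs => by
      set ξ := θs + s • h with hξ
      have he : ∀ i j, |birkhoffAverage ℝ shift (F (i, j) ξ) n (path Y 1 ω)
          - ∫ y, F (i, j) θs y ∂(law μ Y)| ≤ η := fun i j => by
        by_contra hgt
        exact c1 (Set.mem_iUnion.2 ⟨(i, j), ξ, hsegV s hs,
          (hsegd s hs).trans_le (hρle _), (not_le.1 hgt).le⟩)
      have h1 := sum_sum_le_of_abs_le (h := h) he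
      have h2 : (d : ℝ) ^ 2 * η * ‖h‖ ^ 2 ≤ c / 2 * ‖h‖ ^ 2 := by
        gcongr
        rw [hη, mul_div_assoc', div_le_div_iff₀ (by positivity) (by norm_num)]
        nlinarith
      have h3 : ∑ j, h j * ∑ i, h i * (birkhoffAverage ℝ shift (F (i, j) ξ) n (path Y 1 ω)
            - ∫ y, F (i, j) θs y ∂(law μ Y))
          = ∑ j, h j * ∑ i, h i * birkhoffAverage ℝ shift (F (i, j) ξ) n (path Y 1 ω)
            + ∑ j, h j * ∑ i, h i * ∫ ω, (lam f Y (0 : ℕ) ω θs)⁻¹ *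
              (pderiv (lam f Y (0 : ℕ) ω) i θs * pderiv (lam f Y (0 : ℕ) ω) j θs) ∂μ := by
        rw [← Finset.sum_add_distrib]
        refine Finset.sum_congr rfl fun j _ => ?_
        rw [← mul_add, ← Finset.sum_add_distrib]
        congr 1
        refine Finset.sum_congr rfl fun i _ => ?_
        rw [hmean]; ring
      have h4 := hJ h
      have h5 : ∑ j, h j * ∑ i, h i * pderiv2 (LFull f Y n ω) i j ξ
          = n * ∑ j, h j * ∑ i, h i * birkhoffAverage ℝ shift (F (i, j) ξ) n (path Y 1 ω) := by
        simp_rw [hp2 _ _ ξ (hsegV s hs), Finset.mul_sum]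
        refine Finset.sum_congr rfl fun j _ => Finset.sum_congr rfl fun i _ => by ring
      rw [h5]
      have h6 : ∑ j, h j * ∑ i, h i * birkhoffAverage ℝ shift (F (i, j) ξ) n (path Y 1 ω)
          ≤ -(c / 2 * ‖h‖ ^ 2) := by linarith
      calc _ ≤ n * -(c / 2 * ‖h‖ ^ 2) := by gcongr
        _ = _ := by ring
  rw [hθe] at htaylor
  have hcs : (∑ i, h i * pderiv (LFull f Y n ω) i θs) ^ 2 ≤ ‖h‖ ^ 2 * S n ω := by
    have h1 := Finset.sum_mul_sq_le_sq_mul_sq Finset.univ (fun i => h i)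
      (fun i => pderiv (LFull f Y n ω) i θs)
    simp only [hp1] at h1 ⊢
    rwa [← EuclideanSpace.real_norm_sq_eq] at h1
  -- The Taylor bound subtracts `(n c / 4) ‖h‖²`, so the gain is at most `S n ω / (n c)`.
  have hquad := le_of_sq_le_mul (b := n * c / 4) (by positivity) (sq_nonneg _) (hS0 n ω) hcs
  have hfin : S n ω / (4 * (n * c / 4)) < ε * κ n := by
    rw [div_lt_iff₀ (by positivity)]
    linarith
  have : n * (c / 2) * ‖h‖ ^ 2 / 2 = n * c / 4 * ‖h‖ ^ 2 := by ring
  linarith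

end Local

/-! ### Model selection -/

section Selection

variable {Ω : Type*} [MeasurableSpace Ω] {μ : Measure Ω} [IsProbabilityMeasure μ] {d : ℕ}
  {f : Param d → (ℕ → ℕ) → ℝ} {Y : ℤ → Ω → ℕ} {U Θ : Set (Param d)} {θs : Param d}
  {p : ℝ → PMF ℕ} {α : Fin 3 → ℕ → ℝ≥0} {κ : ℕ → ℝ} {M : Finset (Finset (Fin d))}
  {ms : Finset (Fin d)} {thHat : ℕ → Finset (Fin d) → Ω → Param d} {mHat : ℕ → Ω → Finset (Fin d)}

/-- With the radius at most the smallest nonzero `|θ*_i|`, no nonzero coordinate of `θ*` can be set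
to zero within that distance. -/
theorem exists_pos_forall_dist_lt_mem_coordSpace (θs : Param d) :
    ∃ r : ℝ, 0 < r ∧ ∀ (m : Finset (Fin d)) (θ : Param d), θ ∈ coordSpace m → dist θ θs < r →
      θs ∈ coordSpace m := by
  obtain ⟨r, hr, hle⟩ := exists_pos_forall_le (ι := {i // θs i ≠ 0}) (ρ := fun i => |θs i|)
    fun i => abs_pos.2 i.2
  refine ⟨r, hr, fun m θ hθ hd i hi => ?_⟩
  by_contra hne
  have h1 := hle ⟨i, hne⟩
  have h2 := PiLp.norm_apply_le (θ - θs) i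
  rw [← dist_eq_norm] at h2
  simp only [PiLp.sub_apply, hθ i hi, zero_sub, norm_neg, Real.norm_eq_abs] at h2
  simp only at h1
  linarith

/-- With probability tending to one, the selected model is the true one and its estimator is close
to the true parameter. -/
theorem tendsto_measure_not_selected (hΘ : IsCompact Θ) (hstat : StationaryErgodic μ Y)
    (hOD : IsOD μ p (f θs) Y) (hmom : MomentCondition μ Y) (htrue : IsTrueModel M Θ θs ms)
    (hA0 : Identifiable μ f Y Θ) (hA2 : SmoothFamily f U Θ)
    (hA4 : FiniteInformation μ f Y θs) (hA5 : NondegenerateGradient μ f Y θs)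
    (hA6 : DominatedHessian μ f Y U Θ θs) (hLip : LipschitzCondition f Θ α)
    (hκ : PenaltyCondition κ α) (hthHat : IsPQMLE μ f Y Θ M thHat)
    (hmHat : IsSelectedModel μ f Y κ M thHat mHat) {r : ℝ} (hr : 0 < r) :
    Tendsto (fun n => μ {ω | ¬(mHat n ω = ms ∧ dist (thHat n (mHat n ω) ω) θs < r)})
      atTop (𝓝 0) := by
  obtain ⟨hmsM, hθms, hmin⟩ := htrue
  have hθs : θs ∈ Θ := hθms.2
  obtain ⟨c, hc, hlow⟩ := hA0.2
  obtain ⟨r0, hr0, hnear⟩ := exists_tendsto_measure_LFull_near hstat hOD hmom hA2 hθs hA4 hA5 hA6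
    hκ.2.1
  obtain ⟨r2, hr2, hcoord⟩ := exists_pos_forall_dist_lt_mem_coordSpace θs
  set r' := min r (min r0 r2) with hr'
  have hr'0 : 0 < r' := lt_min hr (lt_min hr0 hr2)
  obtain ⟨δ, hδ, hfar⟩ := exists_tendsto_measure_LFull_far hstat hOD hmom hΘ hA0 hA2 hLip hθs hr'0
  -- The constants `1/16` (used at two parameters) and `1/8` bound twice the gain by `2 (1/8 + 2/16)
  -- κ_n = κ_n / 2`, below the price `κ_n` of one extra coordinate.
  have herr := tendsto_measure_LHat_sub_LFull hstat.1 hmom hLip hc hlow hκ (ε := 1 / 16)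
    (by norm_num)
  have hB := (herr.add hfar).add (hnear (1 / 8) (by norm_num))
  simp only [add_zero] at hB
  -- This constant gives `κ_n (d + 1) < δ n`: the loss far from `θ*` exceeds any difference of
  -- penalties plus the approximation error.
  have hlit := hκ.2.2.1.def (c := δ / (2 * (d + 1))) (by positivity)
  refine tendsto_of_tendsto_of_tendsto_of_le_of_le' tendsto_const_nhds hB
    (Eventually.of_forall fun n => zero_le) ?_
  filter_upwards [hκ.2.1.eventually_gt_atTop 0, hlit, eventually_gt_atTop 0] with n hκn hlitn hn0
  have hn' : (0 : ℝ) < n := by exact_mod_cast hn0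
  have hκd : κ n * (d + 1) < δ * n := by
    rw [Real.norm_of_nonneg hκn.le, Real.norm_of_nonneg hn'.le] at hlitn
    calc κ n * (d + 1) ≤ δ / (2 * (d + 1)) * n * (d + 1) := by gcongr
      _ = δ * n / 2 := by field_simp
      _ < δ * n := half_lt_self (by positivity)
  have hth : ∀ᵐ ω ∂μ, ∀ m ∈ M, thHat n m ω ∈ paramSpace Θ m ∧
      IsMaxOn (LHat f Y n ω) (paramSpace Θ m) (thHat n m ω) :=
    (ae_ball_iff M.countable_toSet).2 fun m hm => hthHat n m hm
  refine (measure_mono_ae ?_).trans ((measure_union_le _ _).trans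
    (add_le_add (measure_union_le _ _) le_rfl))
  filter_upwards [hth, hmHat n] with ω hω1 hω2 hbad
  by_contra hcon
  obtain ⟨hcon', c3⟩ := not_or.1 hcon
  obtain ⟨c1, c2⟩ := not_or.1 hcon'
  apply hbad
  obtain ⟨hmM, hcrit⟩ := hω2
  obtain ⟨hmem, -⟩ := hω1 _ hmM
  set m := mHat n ω with hm
  set θ := thHat n m ω with hθ
  have hle := hcrit ms hmsM
  have hmax : LHat f Y n ω θs ≤ LHat f Y n ω (thHat n ms ω) := (hω1 ms hmsM).2 hθms
  simp only [crit] at hle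
  have hE : ∀ η ∈ Θ, |LHat f Y n ω η - LFull f Y n ω η| < 1 / 16 * κ n := fun η hη =>
    not_le.1 fun h => c1 ⟨η, hη, h⟩
  obtain ⟨hE1, hE1'⟩ := abs_lt.1 (hE θ hmem.2)
  obtain ⟨hE2, hE2'⟩ := abs_lt.1 (hE θs hθs)
  have hcd : (ms.card : ℝ) ≤ d := by
    exact_mod_cast (Finset.card_le_univ ms).trans_eq (Fintype.card_fin d)
  have hd : dist θ θs < r' := by
    by_contra hge
    have hf := not_lt.1 fun h => c2 ⟨θ, hmem.2, not_lt.1 hge, h⟩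
    have h1 : κ n * (ms.card : ℝ) ≤ κ n * d := by gcongr
    have h2 : 0 ≤ κ n * (m.card : ℝ) := by positivity
    have h3 : 0 ≤ κ n * (d : ℝ) := by positivity
    linarith
  have hdr0 : dist θ θs < r0 := hd.trans_le ((min_le_right _ _).trans (min_le_left _ _))
  have hdr2 : dist θ θs < r2 := hd.trans_le ((min_le_right _ _).trans (min_le_right _ _))
  have hN : LFull f Y n ω θ - LFull f Y n ω θs < 1 / 8 * κ n :=
    not_le.1 fun h => c3 ⟨θ, hmem.2, hdr0, h⟩
  have hsub : ms ⊆ m := hmin m hmM ⟨hcoord m θ hmem.1 hdr2, hθs⟩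
  refine ⟨?_, hd.trans_le (min_le_left _ _)⟩
  symm
  refine Finset.eq_of_subset_of_card_le hsub ?_
  by_contra hlt
  have h1 : (ms.card : ℝ) + 1 ≤ m.card := by exact_mod_cast not_le.1 hlt
  have h2 : κ n * ((ms.card : ℝ) + 1) ≤ κ n * m.card := by gcongr
  linarith

end Selection

end PoissonQL

/-! ### The theorem -/

theorem mainTheorem1 {Ω : Type*} [MeasurableSpace Ω] (μ : Measure Ω) [IsProbabilityMeasure μ]
    {d : ℕ} (f : PoissonQL.Param d → (ℕ → ℕ) → ℝ) (U Θ : Set (PoissonQL.Param d))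
    (p : ℝ → PMF ℕ) (Y : ℤ → Ω → ℕ) (α : Fin 3 → ℕ → ℝ≥0) (κ : ℕ → ℝ)
    (M : Finset (Finset (Fin d))) (θs : PoissonQL.Param d) (ms : Finset (Fin d))
    (thHat : ℕ → Finset (Fin d) → Ω → PoissonQL.Param d) (mHat : ℕ → Ω → Finset (Fin d))
    (hΘ : IsCompact Θ)
    (hstat : PoissonQL.StationaryErgodic μ Y)
    (hOD : PoissonQL.IsOD μ p (f θs) Y)
    (hmom : PoissonQL.MomentCondition μ Y)
    (htrue : PoissonQL.IsTrueModel M Θ θs ms)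
    (hA0 : PoissonQL.Identifiable μ f Y Θ)
    (hA1 : PoissonQL.InteriorParam Θ θs ms)
    (hA2 : PoissonQL.SmoothFamily f U Θ)
    (hA3 : PoissonQL.InitialValueNegligible μ f Y Θ)
    (hA4 : PoissonQL.FiniteInformation μ f Y θs)
    (hA5 : PoissonQL.NondegenerateGradient μ f Y θs)
    (hA6 : PoissonQL.DominatedHessian μ f Y U Θ θs)
    (hA7 : PoissonQL.InitialValueRate μ f Y Θ)
    (hLip : PoissonQL.LipschitzCondition f Θ α)
    (hκ : PoissonQL.PenaltyCondition κ α)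
    (hthHat : PoissonQL.IsPQMLE μ f Y Θ M thHat)
    (hmHat : PoissonQL.IsSelectedModel μ f Y κ M thHat mHat) :
    Tendsto (fun n : ℕ => μ {ω | mHat n ω = ms}) atTop (𝓝 1) ∧
      TendstoInMeasure μ (fun n ω => thHat n (mHat n ω) ω) atTop (fun _ => θs) := by
  have key := fun r (hr : (0 : ℝ) < r) => PoissonQL.tendsto_measure_not_selected hΘ hstat hOD hmom
    htrue hA0 hA2 hA4 hA5 hA6 hLip hκ hthHat hmHat hr
  constructor
  · have h1 : Tendsto (fun n => 1 - μ {ω | ¬(mHat n ω = ms ∧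
        dist (thHat n (mHat n ω) ω) θs < 1)}) atTop (𝓝 1) := by
      simpa using ENNReal.Tendsto.sub tendsto_const_nhds (key 1 one_pos) (Or.inl ENNReal.one_ne_top)
    refine tendsto_of_tendsto_of_tendsto_of_le_of_le h1 tendsto_const_nhds (fun n => ?_)
      fun n => prob_le_one
    -- No measurability of `mHat` is assumed, so the complement is handled by subadditivity.
    rw [tsub_le_iff_right, ← measure_univ (μ := μ)]
    refine (measure_mono fun ω _ => ?_).trans (measure_union_le _ _)
    by_cases h : mHat n ω = ms
    · exact Or.inl h
    · exact Or.inr fun h' => h h'.1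
  · rw [tendstoInMeasure_iff_dist]
    intro ε hε
    refine tendsto_of_tendsto_of_tendsto_of_le_of_le tendsto_const_nhds (key ε hε)
      (fun n => zero_le) fun n => measure_mono fun ω hω h => ?_
    exact absurd h.2 (not_lt.2 hω)
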